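/- For a prime $p$ let $\omega=e^{2\pi i/p}$ and $\mathcal G=\mathrm{Gal}(\mathbb Q(\omega)/\mathbb Q)$. Let $P_{p^k}=C_p\wr\cdots\wr C_p$ ($k$ factors, $P_{p^0}=1$, $P_{p^{k}}=P_{p^{k-1}}\wr C_p$) be viewed, through its canonical permutation representation on $p^k$ points, as a Sylow $p$-subgroup of $S_{p^k}$. For a Sylow $p$-subgroup $P$ of $S_n$, $\sigma\in\mathcal G$ and $h\in N_{S_n}(P)$, write $\chi^\sigma(x)=\sigma(\chi(x))$ for a character $\chi$ of $P$ with values in $\mathbb Q(\omega)$, and $\chi^h(x)=\chi(hxh^{-1})$. A $p^k$-labelling function $t$ assigns a label in $\{0,\dots,p\}$ to every sequence of length $<k$ with entries in $\{1,\dots,p\}$; for $1\le i\le p$ let $t_{(i)}$ be the $p^{k-1}$-labelling function $\mathtt s\mapsto t(i\mathtt s)$. Two labelling functions are equivalent if they differ by cyclic rotations of the children of vertices. A labelling function $t$ is admissible if at every vertex the $p$ labelling subfunctions below it are all equivalent when its label is $<p$, and not all equivalent when its label is $p$ (so the labels of sequences of length $k-1$ are $<p$). To $t$ one associates a character $\theta(t)$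 of $P_{p^k}$ recursively: for $k=0$ it is trivial; for $k\ge1$, if $t(\emptyset)=p$, it is the character $(\theta(t_{(1)})\times\cdots\times\theta(t_{(p)}))\uparrow^{P_{p^k}}$ induced from the base group $(P_{p^{k-1}})^{\times p}$; if $t(\emptyset)=\varepsilon<p$, it is $\mathcal X(\theta(t_{(1)});\phi_\varepsilon)$, where $\phi_\varepsilon\in\mathrm{Irr}(C_p)$ sends the fixed generator to $\omega^\varepsilon$ and $\mathcal X(\phi;\psi)$ is the character of $G\wr C_p$ afforded by $V^{\otimes p}$ with $(g_1,\dots,g_p;h)$ acting by $v_1\otimes\cdots\otimes v_p\mapsto g_1v_{h^{-1}(1)}\otimes\cdots\otimes g_pv_{h^{-1}(p)}$ (where $V$ affords $\phi$), multiplied by the inflation of $\psi$. Let $p=5$, $n=125$. Define $125$-labelling functions by $$t_1^{-1}(5)=\{\emptyset,1\},\quad t_1^{-1}(1)=\{3,13,14,15\},\quad t_1^{-1}(2)=\{4\},\quad t_1^{-1}(3)=\{5\},$$ $$t_2^{-1}(5)=\{\emptyset,1\},\quad t_2^{-1}(3)=\{3,13,14,15\},\quad t_2^{-1}(1)=\{4\},\quad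 t_2^{-1}(4)=\{5\},$$ all other labels being $0$. Then $t_1,t_2$ are admissible, and $\theta(t_1),\theta(t_2)$ are irreducible characters of $P_{125}$ of degree $25$ such that - $\theta(t_2)=\theta(t_1)^\sigma$, where $\sigma$ is the generator of $\mathcal G=\mathrm{Gal}(\mathbb Q(\omega)/\mathbb Q)$ with $\sigma(\omega)=\omega^3$; - there is no $h\in N_{125}=N_{S_{125}}(P_{125})$ with $\theta(t_2)=\theta(t_1)^h$; - $\theta(t_1)$ and $\theta(t_2)$ nevertheless induce the same character of $S_{125}$. So Galois conjugate irreducible characters of $P_n$ need not be $N_{S_n}(P_n)$-conjugate. For linear characters, by contrast, Galois conjugacy does imply normalizer conjugacy: for every prime $p$, every $n\ge0$, every Sylow $p$-subgroup $P$ of $S_n$ and every $\sigma\in\mathcal G$ there is $h\in N_{S_n}(P)$ such that every linear character $\lambda$ of $P$ has values in $\mathbb Q(\omega)$ and satisfies $\lambda^\sigma=\lambda^h$. -/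

import Mathlib

open scoped TensorProduct

noncomputable section

namespace SylowChar

/-! ### Representations of wreath products -/

section Wreath

variable {D Q : Type} [Group D] [Group Q]

/-- The inclusion of the base group `D^Q` into `D ≀ Q`. -/
def baseHom : (Q → D) →* D ≀ᵣ Q where
  toFun f := ⟨f, 1⟩
  map_one' := rfl
  map_mul' f g := by ext <;> simp

/-- The outer tensor product of a family of representations of `D`, a representation of the base
group `D^Q`; it affords the product character `f ↦ ∏ i, φ i (f i)`. -/
def outerTensor {V : Q → Type} [∀ i, AddCommGroup (V i)] [∀ i, Module ℂ (V i)]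
    (ρ : ∀ i, Representation ℂ D (V i)) :
    Representation ℂ (Q → D) (⨂[ℂ] i, V i) where
  toFun f := PiTensorProduct.map fun i => ρ i (f i)
  map_one' := by ext v; simp
  map_mul' f g := by ext v; simp

/-- The extension to `D ≀ Q` of the outer tensor power of a representation `ρ` of `D`:
`(f; h)` sends `⨂ v_i` to `⨂ ρ(f_i) v_{h⁻¹ i}`. -/
def tensorPower {V : Type} [AddCommGroup V] [Module ℂ V] (ρ : Representation ℂ D V) :
    Representation ℂ (D ≀ᵣ Q) (⨂[ℂ] _ : Q, V) where
  toFun w := (PiTensorProduct.map fun i => ρ (w.left i)) ∘ₗ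
    (PiTensorProduct.reindex ℂ (fun _ : Q => V) (Equiv.mulLeft w.right)).toLinearMap
  map_one' := by
    ext v
    simp only [LinearMap.compMultilinearMap_apply, LinearMap.comp_apply, LinearEquiv.coe_coe,
      PiTensorProduct.reindex_tprod, PiTensorProduct.map_tprod]
    exact congrArg (PiTensorProduct.tprod ℂ) (funext fun i => by
      simp [-Equiv.mulLeft_one])
  map_mul' a b := by
    ext v
    simp only [LinearMap.compMultilinearMap_apply, LinearMap.comp_apply, LinearEquiv.coe_coe,
      PiTensorProduct.reindex_tprod, PiTensorProduct.map_tprod, Module.End.mul_apply]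
    exact congrArg (PiTensorProduct.tprod ℂ) (funext fun i => by
      simp [mul_assoc, -Equiv.mulLeft_mul])

/-- `X(ρ; ψ)`: the extended tensor power of `ρ`, multiplied by the inflation to `D ≀ Q` of a linear
character `ψ` of the top group `Q`. -/
def extendedTensor {V : Type} [AddCommGroup V] [Module ℂ V] (ρ : Representation ℂ D V)
    (ψ : Q →* ℂ) : Representation ℂ (D ≀ᵣ Q) (⨂[ℂ] _ : Q, V) where
  toFun w := ψ w.right • tensorPower ρ w
  map_one' := by simp
  map_mul' a b := by simp only [RegularWreathProduct.mul_right, map_mul, smul_mul_smul_comm]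

end Wreath

/-! ### The Sylow subgroup `P_{p^k}` -/

/-- The cyclic group `C_p`, with generator `Multiplicative.ofAdd 1`. -/
abbrev Cyc (p : ℕ) : Type := Multiplicative (ZMod p)

/-- The set of cardinality `p ^ k` on which the symmetric group `S_{p^k}` acts. -/
abbrev Pts (p k : ℕ) : Type := Fin k → Cyc p

/-- The `k`-fold iterated wreath product `C_p ≀ ⋯ ≀ C_p`. -/
abbrev Wr (p k : ℕ) : Type := IteratedWreathProduct (Cyc p) k

/-- The identification of `Wr p (k + 1)` with `Wr p k ≀ C_p`. -/
def wrSucc (p k : ℕ) : Wr p (k + 1) ≃* (Wr p k ≀ᵣ Cyc p) where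
  toFun w := w
  invFun w := w
  left_inv _ := rfl
  right_inv _ := rfl
  map_mul' _ _ := rfl

/-- The iterated wreath product in its canonical permutation representation on `p ^ k` points, as a
Sylow `p`-subgroup of the symmetric group. -/
def sylowWr (p : ℕ) [Fact p.Prime] (k : ℕ) : Sylow p (Equiv.Perm (Pts p k)) :=
  Sylow.ofCard (iteratedWreathToPermHom (Cyc p) k).range (by
    have hG : Nat.card (Cyc p) = p := by simp [Cyc]
    rw [Nat.card_congr
        (MonoidHom.ofInjective (iteratedWreathToPermHomInj (Cyc p) k)).symm.toEquiv,
      IteratedWreathProduct.card, hG, Nat.card_perm, Nat.card_fun, Nat.card_fin, hG,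
      ← Nat.multiplicity_eq_factorization (Fact.out : p.Prime) (p ^ k).factorial_ne_zero,
      Nat.Prime.multiplicity_factorial_pow Fact.out])

/-- The canonical isomorphism of the Sylow subgroup with the iterated wreath product. -/
def sylowEquiv (p : ℕ) [Fact p.Prime] (k : ℕ) : ↥(sylowWr p k) ≃* Wr p k :=
  (MonoidHom.ofInjective (iteratedWreathToPermHomInj (Cyc p) k)).symm

/-- The linear character `φ_ε` of `C_p`, sending the generator to `ω ^ ε`, where
`ω = exp (2 π i / p)`. -/
def phi (p : ℕ) [Fact p.Prime] (ε : ZMod p) : Cyc p →* ℂ :=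
  (ZMod.stdAddChar.mulShift ε : AddChar (ZMod p) ℂ).toMonoidHom

/-! ### Labelling functions and the corresponding characters

A vertex of the `p^k`-skeleton is a list of length `< k` of elements of `{1, …, p}`, read modulo `p`
(so that the child number `p` is the child `0`). A `p^k`-labelling function assigns to each
vertex a label in `{0, …, p}`; its values on lists of length `≥ k` are never used. -/

/-- Labelling functions of the complete rooted `p`-ary tree. -/
abbrev Labelling (p : ℕ) : Type := List (ZMod p) → Fin (p + 1)

/-- The labelling subfunction rooted at the `i`-th child of the root. -/
def Labelling.sub {p : ℕ} (t : Labelling p) (i : ZMod p) : Labelling p := fun s => t (i :: s)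

/-- Two `p^k`-labelling functions are equivalent (define the same tree function) if they differ by
cyclic rotations of the children of the vertices. -/
def TreeEquiv {p : ℕ} : ℕ → Labelling p → Labelling p → Prop
  | 0, _, _ => True
  | k + 1, t, t' => t [] = t' [] ∧ ∃ c : ZMod p, ∀ i, TreeEquiv k (t.sub i) (t'.sub (i + c))

/-- Admissible `p^k`-labelling functions: at every vertex the `p` tree subfunctions below it are all
equal if the label is `< p`, and not all equal if the label is `p`. -/
def Admissible {p : ℕ} : ℕ → Labelling p → Prop
  | 0, _ => True
  | k + 1, t => (∀ i, Admissible k (t.sub i)) ∧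
      (t [] ≠ Fin.last p ↔ ∀ i j, TreeEquiv k (t.sub i) (t.sub j))

/-- The representation of the iterated wreath product attached to a `p^k`-labelling function. If the
root is labelled `p`, it is induced from the outer tensor product of the representations attached
to the subfunctions below the root; if it is labelled `ε < p`, it is `X(ρ; φ_ε)`, where `ρ` is
attached to the first of these subfunctions. -/
def treeRep (p : ℕ) [Fact p.Prime] : (k : ℕ) → Labelling p → Rep.{0} ℂ (Wr p k)
  | 0, _ => Rep.of (Representation.trivial ℂ (Wr p 0) ℂ)
  | k + 1, t =>
      if t [] = Fin.last p then
        Rep.of ((Representation.ind baseHom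
          (outerTensor fun i : Cyc p => (treeRep p k (t.sub i.toAdd)).ρ)).comp
          (wrSucc p k).toMonoidHom)
      else
        Rep.of ((extendedTensor (treeRep p k (t.sub 1)).ρ (phi p ((t [] : ℕ) : ZMod p))).comp
          (wrSucc p k).toMonoidHom)

/-- The character `θ(T)` of the Sylow subgroup `P_{p^k}` corresponding to a `p^k`-labelling function
representing `T`. -/
def treeChar (p : ℕ) [Fact p.Prime] (k : ℕ) (t : Labelling p) : ↥(sylowWr p k) → ℂ :=
  fun x => (treeRep p k t).ρ.character (sylowEquiv p k x)

/-! ### Characters, Galois action, action of the normalizer -/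

/-- `χ` is an irreducible complex character of the finite group `G`. -/
def IsIrrChar {G : Type} [Group G] (χ : G → ℂ) : Prop :=
  ∃ V : FDRep ℂ G, CategoryTheory.Simple V ∧ V.character = χ

/-- The primitive `p`-th root of unity `ω = exp (2 π i / p)`. -/
def omega (p : ℕ) : ℂ := Complex.exp (2 * Real.pi * Complex.I / p)

/-- The cyclotomic field `ℚ(ω)` inside `ℂ`. -/
abbrev cycField (p : ℕ) : IntermediateField ℚ ℂ := IntermediateField.adjoin ℚ {omega p}

/-- The element `ω` of `ℚ(ω)`. -/
def omegaK (p : ℕ) : cycField p :=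
  ⟨omega p, IntermediateField.mem_adjoin_simple_self ℚ (omega p)⟩

/-- `ψ = χ^σ`: the values of `χ` lie in `ℚ(ω)`, and `ψ` is obtained by applying `σ` to them. -/
def IsGaloisImage {p : ℕ} {G : Type} (σ : Gal(cycField p/ℚ)) (χ ψ : G → ℂ) : Prop :=
  ∀ g, ∃ z : cycField p, (z : ℂ) = χ g ∧ ((σ z : cycField p) : ℂ) = ψ g

/-- `χ^h`, the function `x ↦ χ (h x h⁻¹)` on `P`, for `h` in the normalizer of `P`. -/
def conjBy {G : Type} [Group G] {P : Subgroup G} (χ : ↥P → ℂ)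
    (h : Subgroup.normalizer (P : Set G)) : ↥P → ℂ :=
  fun x => χ (P.normalizerMonoidHom h x)

open scoped Classical in
/-- The function on the finite group `G` induced from `χ : P → ℂ`, that is
`g ↦ |P|⁻¹ ∑ x, χ° (x g x⁻¹)`, where `χ°` is `χ` extended by zero. -/
def inducedFun {G : Type} [Group G] {P : Subgroup G} (χ : ↥P → ℂ) : G → ℂ :=
  fun g => (Nat.card P : ℂ)⁻¹ *
    ∑ᶠ x : G, if hx : x * g * x⁻¹ ∈ P then χ ⟨x * g * x⁻¹, hx⟩ else 0

/-! ### The two labelling functions -/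

instance fact_prime_five : Fact (Nat.Prime 5) := ⟨by norm_num⟩

/-- The first `125`-labelling function. -/
def t₁ : Labelling 5 := fun s =>
  if s ∈ ([[], [1]] : List (List (ZMod 5))) then 5
  else if s ∈ ([[3], [1, 3], [1, 4], [1, 5]] : List (List (ZMod 5))) then 1
  else if s = [4] then 2
  else if s = [5] then 3
  else 0

/-- The second `125`-labelling function. -/
def t₂ : Labelling 5 := fun s =>
  if s ∈ ([[], [1]] : List (List (ZMod 5))) then 5
  else if s = [4] then 1
  else if s ∈ ([[3], [1, 3], [1, 4], [1, 5]] : List (List (ZMod 5))) then 3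
  else if s = [5] then 4
  else 0

end SylowChar

end

open SylowChar

/-! The labels of `t₂` are those of `t₁` multiplied by 3 modulo 5, so both characters belong to one
family `rootChar u`, with u = 1 and u = 3. A representation induced from the base group permutes its
summands by translations of the top group. Its character is therefore supported on the base group,
where it is a sum of translated products (`trace_ind_baseHom`, `indFun`). The other vertices that
matter carry inflated linear characters.

Raising fifth roots of unity to the third power multiplies all labels by 3, which gives Galois
conjugacy. It also gives `rootChar_pow`: the second character is the first one composed with x ↦ x³.
In a symmetric group an element of 5-power order is conjugate to its cube, so the induced functions
agree (`inducedFun_eq_of_pow`). Irreducibility is the norm computation `sum_indFun_mul_inv`.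

A normalizing permutation acts affinely on the children of the root and, with one common slope u, on
the children of each of them (`normalizer_structure`). Let a be the slope at the root. The labels 0,
1, 2, 3 of children 2, 3, 4, 5 force a = 1 and u = 3 (`scalars_eq`). Slope 3 turns an adjacent pair
of grandchildren into a pair at cyclic distance 2, and the three consecutive labels 1 below the
first child tell these apart (`distribution_ne`). So the Galois action multiplies all labels by 3,
but no single normalizer element achieves this at both levels.

Linear characters see no such rigidity. Take a Sylow subgroup built recursively as C_p ≀ P_{⌊n/p⌋}
with n mod p extra fixed points. Taking m-th powers in the bottom copies of C_p, compatibly with the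
recursive permutation, raises every linear character to the m-th power (`exists_sylow_model`). Their
values are p-th roots of unity, so this is the Galois action. -/

namespace SylowChar

/-! ### Linear characters of Sylow subgroups of symmetric groups -/

section LinearCharacters

/-- A permutation `h` of the `G`-set `α` normalizing the action of `G` (by way of `τ`), preserving
every orbit, and acting on the linear characters of `G` as the `m`-th power map. -/
structure ActsAsPower (m : ℕ) {α G : Type} [Group G] [MulAction G α] (h : Equiv.Perm α)
    (τ : G → G) : Prop where
  smul_comm : ∀ g a, h (g • a) = τ g • h a
  orbit : ∀ a, ∃ g : G, h a = g • a
  linear : ∀ (l : G →* ℂˣ) (g : G), l (τ g) = l g ^ m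

/-- A semidirect product `C_p^α ⋊ G` acts on the disjoint union of `C_p × α` and a set `β`, fixing
`β` pointwise. -/
@[reducible]
def wreathSumAction (C α β G : Type) [Group C] [Group G] [MulAction G α] :
    MulAction ((α → C) ⋊[mulAutArrow] G) ((C × α) ⊕ β) where
  smul w x := Sum.map (fun y => (w.left (w.right • y.2) * y.1, w.right • y.2)) id x
  one_smul x := by
    rcases x with ⟨x, a⟩ | b
    · exact congrArg Sum.inl (by simp)
    · rfl
  mul_smul v w x := by
    rcases x with ⟨x, a⟩ | b
    · refine congrArg Sum.inl ?_
      have : (mulAutArrow v.right) w.left (v.right • w.right • a) = w.left (w.right • a) := by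
        change w.left (v.right⁻¹ • v.right • w.right • a) = _
        rw [inv_smul_smul]
      simp [mul_smul, this, mul_assoc]
    · rfl

/-- An iterative construction of a Sylow `p`-subgroup of the symmetric group of degree `n`, as a
faithful permutation group of the appropriate order, with its linear characters. -/
theorem exists_sylow_model (p : ℕ) [hp : Fact p.Prime] (n : ℕ) :
    ∃ (α G : Type) (_ : Fintype α) (_ : Group G) (_ : MulAction G α),
      Nat.card α = n ∧ FaithfulSMul G α ∧ Nat.card G = p ^ padicValNat p n.factorial ∧
      (∀ (l : G →* ℂˣ) (g : G), l g ^ p = 1) ∧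
      ∀ m : ℕ, m.Coprime p → ∃ (h : Equiv.Perm α) (τ : G → G), ActsAsPower m h τ := by
  induction n using Nat.strong_induction_on with
  | _ n ih =>
  rcases Nat.eq_zero_or_pos n with rfl | hn
  · refine ⟨Empty, Unit, inferInstance, inferInstance,
      { smul := fun _ b => b, one_smul := fun _ => rfl, mul_smul := fun _ _ _ => rfl }, by simp,
      ⟨fun _ => Subsingleton.elim _ _⟩, by simp, fun l g => ?_, fun m hm => ⟨1, id, ?_, ?_, ?_⟩⟩
    · rw [Subsingleton.elim g 1, map_one, one_pow]
    · exact fun _ a => a.elim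
    · exact fun a => a.elim
    · intro l g
      rw [Subsingleton.elim g 1, id, map_one, one_pow]
  obtain ⟨α, G, _, _, _, hα, hF, hG, hl, hh⟩ := ih (n / p) (Nat.div_lt_self hn hp.out.one_lt)
  classical
  let _ : MulAction ((α → Cyc p) ⋊[mulAutArrow] G) ((Cyc p × α) ⊕ Fin (n % p)) :=
    wreathSumAction (Cyc p) α (Fin (n % p)) G
  have smul_inl : ∀ (w : (α → Cyc p) ⋊[mulAutArrow] G) (x : Cyc p) (a : α),
      w • (Sum.inl (x, a) : (Cyc p × α) ⊕ Fin (n % p)) =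
        Sum.inl (w.left (w.right • a) * x, w.right • a) := fun _ _ _ => rfl
  have hC : Nat.card (Cyc p) = p := by simp [Cyc]
  have split : ∀ (l : (α → Cyc p) ⋊[mulAutArrow] G →* ℂˣ) w,
      l w = l (SemidirectProduct.inl w.left) * l (SemidirectProduct.inr w.right) := by
    intro l w
    rw [← map_mul, SemidirectProduct.inl_left_mul_inr_right]
  have hpow : ∀ c : Cyc p, c ^ p = 1 := fun c => by
    have := pow_card_eq_one' (x := c)
    rwa [hC] at this
  refine ⟨(Cyc p × α) ⊕ Fin (n % p), (α → Cyc p) ⋊[mulAutArrow] G, inferInstance, inferInstance,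
    inferInstance, ?_, ⟨?_⟩, ?_, ?_, ?_⟩
  · rw [Nat.card_sum, Nat.card_prod, hC, hα, Nat.card_fin]
    exact Nat.div_add_mod n p
  · intro v w hvw
    have key : ∀ a, v.left (v.right • a) = w.left (w.right • a) ∧ v.right • a = w.right • a := by
      intro a
      have := hvw (Sum.inl (1, a))
      simpa [smul_inl] using this
    have hr : v.right = w.right := FaithfulSMul.eq_of_smul_eq_smul fun a => (key a).2
    refine SemidirectProduct.ext (funext fun a => ?_) hr
    have := (key (v.right⁻¹ • a)).1
    rwa [← hr, smul_inv_smul] at this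
  -- Legendre's formula in recursive form: v(n!) = ⌊n/p⌋ + v(⌊n/p⌋!).
  · rw [SemidirectProduct.card, Nat.card_fun, hC, hα, hG, ← padicValNat_mul_div_factorial n,
      padicValNat_factorial_mul, pow_add, mul_comm]
  · intro l w
    have h1 : l (SemidirectProduct.inl w.left) ^ p = 1 := by
      rw [← map_pow, ← map_pow, show w.left ^ p = 1 from funext fun a => hpow _, map_one, map_one]
    have h2 := hl (l.comp SemidirectProduct.inr) w.right
    rw [MonoidHom.comp_apply] at h2
    rw [split, mul_pow, h1, h2, one_mul]
  · intro m hm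
    obtain ⟨h, τ, hτ⟩ := hh m hm
    let e : Equiv.Perm (Cyc p) := powCoprime (n := m) (by rw [hC]; exact hm.symm)
    have he : ∀ x, e x = x ^ m := fun _ => rfl
    -- The permutation is (x, a) ↦ (x ^ m, h a). Conjugating by it moves the base coordinate at `a`
    -- to `h a` and raises it to the m-th power.
    refine ⟨Equiv.sumCongr (Equiv.prodCongr e h) (Equiv.refl _),
      fun w => ⟨fun a => w.left (h.symm a) ^ m, τ w.right⟩, ?_, ?_, ?_⟩
    · rintro w (⟨x, a⟩ | b)
      · simp [smul_inl, he, ← hτ.smul_comm, mul_pow]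
      · rfl
    · rintro (⟨x, a⟩ | b)
      · obtain ⟨g, hg⟩ := hτ.orbit a
        -- A constant base function suffices, since it only has to carry x to x ^ m in one fibre.
        refine ⟨⟨fun _ => x ^ m * x⁻¹, g⟩, ?_⟩
        simp [smul_inl, he, hg]
      · exact ⟨1, rfl⟩
    · intro l w
      -- As `h` preserves orbits, `h a` and `a` are related by some `g`, and the two one-coordinate
      -- elements are conjugate. A linear character cannot separate them, so permuting base
      -- coordinates by `h` is invisible to it.
      have single : ∀ (a : α) (x : Cyc p), l (SemidirectProduct.inl (Pi.mulSingle (h a) x)) =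
          l (SemidirectProduct.inl (Pi.mulSingle a x)) := by
        intro a x
        obtain ⟨g, hg⟩ := hτ.orbit a
        have : (Pi.mulSingle (h a) x : α → Cyc p) = mulAutArrow g (Pi.mulSingle a x) := by
          funext b
          change _ = (Pi.mulSingle a x : α → Cyc p) (g⁻¹ • b)
          simp only [Pi.mulSingle_apply, hg, inv_smul_eq_iff]
        rw [this, SemidirectProduct.inl_aut]
        rw [map_mul, map_mul, map_inv, map_inv, mul_inv_cancel_comm]
      have perm : l (SemidirectProduct.inl fun a => w.left (h.symm a)) =
          l (SemidirectProduct.inl w.left) := by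
        have e1 : (fun a => w.left (h.symm a)) = ∏ a, Pi.mulSingle (h a) (w.left a) := by
          rw [← Equiv.prod_comp h.symm]
          simpa using (Finset.univ_prod_mulSingle fun a => w.left (h.symm a)).symm
        have e2 : w.left = ∏ a, Pi.mulSingle a (w.left a) :=
          (Finset.univ_prod_mulSingle _).symm
        change (l.comp SemidirectProduct.inl) _ = (l.comp SemidirectProduct.inl) _
        rw [e1]
        conv_rhs => rw [e2]
        rw [map_prod, map_prod]
        exact Finset.prod_congr rfl fun a _ => single a _
      have h2 := hτ.linear (l.comp SemidirectProduct.inr) w.right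
      simp only [MonoidHom.comp_apply] at h2
      rw [split, split l w, mul_pow]
      dsimp only
      rw [h2, ← perm, show (fun a => w.left (h.symm a) ^ m) =
        (fun a => w.left (h.symm a)) ^ m from rfl, map_pow, map_pow]

/-- Every Sylow `p`-subgroup `P` of `S_n` has linear characters of exponent `p`, and for `m` prime
to `p` some element of its normalizer acts on them as the `m`-th power map. -/
theorem sylow_perm_linear (p n : ℕ) [hp : Fact p.Prime] (P : Sylow p (Equiv.Perm (Fin n))) :
    (∀ (l : ↥P →* ℂˣ) (x : ↥P), l x ^ p = 1) ∧ ∀ m : ℕ, m.Coprime p →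
      ∃ h : Subgroup.normalizer ((P : Subgroup (Equiv.Perm (Fin n))) :
          Set (Equiv.Perm (Fin n))),
        ∀ (l : ↥P →* ℂˣ) (x : ↥(P : Subgroup (Equiv.Perm (Fin n)))),
          l ((P : Subgroup (Equiv.Perm (Fin n))).normalizerMonoidHom h x) = l x ^ m := by
  obtain ⟨α, G, _, _, _, hα, hF, hG, hl, hh⟩ := exists_sylow_model p n
  let e₀ : α ≃ Fin n := Finite.equivFinOfCardEq hα
  let ι₀ : G →* Equiv.Perm (Fin n) :=
    e₀.permCongrHom.toMonoidHom.comp (MulAction.toPermHom G α)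
  have hι₀ : Function.Injective ι₀ :=
    e₀.permCongrHom.injective.comp MulAction.toPerm_injective
  let P₀ : Sylow p (Equiv.Perm (Fin n)) := Sylow.ofCard ι₀.range (by
    rw [Nat.card_congr (MonoidHom.ofInjective hι₀).symm.toEquiv, hG, Nat.card_perm, Nat.card_fin,
      Nat.factorization_def _ hp.out])
  obtain ⟨y, hy⟩ := MulAction.exists_smul_eq (Equiv.Perm (Fin n)) P₀ P
  -- Relabelling the points by the conjugating permutation makes the image of `G` equal to `P`
  -- itself.
  let e : α ≃ Fin n := e₀.trans y
  let ι : G →* Equiv.Perm (Fin n) := e.permCongrHom.toMonoidHom.comp (MulAction.toPermHom G α)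
  have hι : Function.Injective ι := e.permCongrHom.injective.comp MulAction.toPerm_injective
  have ι_apply : ∀ g a, ι g (e a) = e (g • a) := fun g a => by simp [ι]
  have hconj : ∀ g, ι g = y * ι₀ g * y⁻¹ := fun g => by
    ext x
    simp [ι, ι₀, e]
  have hrange : ι.range = (P : Subgroup (Equiv.Perm (Fin n))) := by
    rw [← hy]
    ext x
    rw [Sylow.coe_subgroup_smul, Subgroup.mem_pointwise_smul_iff_inv_smul_mem, Sylow.coe_ofCard,
      ← map_inv, MulAut.smul_def, MulAut.conj_apply, inv_inv]
    refine exists_congr fun g => ?_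
    rw [hconj, mul_inv_eq_iff_eq_mul, ← eq_inv_mul_iff_mul_eq, mul_assoc]
  let E : G ≃* ↥P := (MonoidHom.ofInjective hι).trans (MulEquiv.subgroupCongr hrange)
  have hE : ∀ g, ((E g : ↥P) : Equiv.Perm (Fin n)) = ι g := fun g => rfl
  refine ⟨fun l x => ?_, fun m hm => ?_⟩
  · have := hl (l.comp E.toMonoidHom) (E.symm x)
    simpa using this
  obtain ⟨h, τ, hτ⟩ := hh m hm
  have key : ∀ g, e.permCongrHom h * ι g * (e.permCongrHom h)⁻¹ = ι (τ g) := by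
    intro g
    rw [mul_inv_eq_iff_eq_mul]
    ext x
    obtain ⟨a, rfl⟩ := e.surjective x
    simp [ι, hτ.smul_comm]
  refine ⟨⟨e.permCongrHom h, ?_⟩, fun l x => ?_⟩
  · refine Subgroup.mem_normalizer_fintype ?_
    intro x hx
    rw [SetLike.mem_coe, ← hrange] at hx ⊢
    obtain ⟨g, rfl⟩ := hx
    exact ⟨τ g, (key g).symm⟩
  · obtain ⟨g, rfl⟩ := E.surjective x
    have h1 := hτ.linear (l.comp E.toMonoidHom) g
    simp only [MonoidHom.comp_apply, MulEquiv.coe_toMonoidHom] at h1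
    rw [← h1]
    congr 1
    apply Subtype.ext
    rw [hE, ← key]
    rfl

end LinearCharacters

/-! ### Characters of induced representations and of tensor powers -/

section CharacterFormulas

section Induction

variable {k D Q A : Type} [CommRing k] [Group D] [Group Q] [AddCommGroup A] [Module k A]

/-- The map from a representation of `D ≀ Q` induced from `ρ` on the base group to a direct sum of
copies of the space of `ρ`. -/
noncomputable def indBaseMap [DecidableEq Q] (ρ : Representation k (Q → D) A) :
    Representation.IndV baseHom ρ →ₗ[k] (Q → A) :=
  Representation.Coinvariants.lift _
    (TensorProduct.lift <| (Finsupp.lift _ _ _ fun h : D ≀ᵣ Q =>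
      LinearMap.single k (fun _ : Q => A) h.right ∘ₗ ρ h.left⁻¹) ∘ₗ
      (MonoidAlgebra.coeffLinearEquiv k).toLinearMap)
    fun f => by
      refine TensorProduct.ext (MonoidAlgebra.lhom_ext' fun h => LinearMap.ext_ring ?_)
      refine LinearMap.ext fun x => ?_
      have h1 : (baseHom f * h).right = h.right := one_mul _
      have h2 : (baseHom f * h).left = f * h.left := by
        funext i
        simp [baseHom]
      have h3 : ρ (f * h.left)⁻¹ (ρ f x) = ρ h.left⁻¹ x := by
        rw [← Module.End.mul_apply, ← map_mul, mul_inv_rev, inv_mul_cancel_right]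
      simp [h1, h2, -mul_inv_rev, h3]

theorem indBaseMap_mk [DecidableEq Q] (ρ : Representation k (Q → D) A) (h : D ≀ᵣ Q) (a : A) :
    indBaseMap ρ (Representation.IndV.mk baseHom ρ h a) =
      Pi.single h.right (ρ h.left⁻¹ a) := by
  simp [indBaseMap]

/-- Every element is a base element times a top element, and the coinvariants absorb the base factor
into `A`. Hence the top elements index all the summands. -/
theorem indV_mk_eq (ρ : Representation k (Q → D) A) (h : D ≀ᵣ Q) (a : A) :
    Representation.IndV.mk baseHom ρ h a =
      Representation.IndV.mk baseHom ρ (⟨1, h.right⟩ : D ≀ᵣ Q) (ρ h.left⁻¹ a) := by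
  have h1 : baseHom h.left * (⟨1, h.right⟩ : D ≀ᵣ Q) = h := by
    ext <;> simp [baseHom]
  have := Representation.Coinvariants.mk_self_apply
    (Representation.tprod ((Representation.leftRegular k (D ≀ᵣ Q)).comp baseHom) ρ) h.left
    (MonoidAlgebra.single (⟨1, h.right⟩ : D ≀ᵣ Q) 1 ⊗ₜ[k] ρ h.left⁻¹ a)
  refine Eq.trans ?_ this
  simp [h1]

/-- A linear map onto a direct sum of copies of `A`, inverse to a given family of maps from `A`. -/
noncomputable def equivPiOfSections {M : Type} [AddCommGroup M] [Module k M]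
    [Fintype Q]
    [DecidableEq Q] (F : M →ₗ[k] (Q → A)) (s : Q → A →ₗ[k] M)
    (h₁ : ∀ q a, F (s q a) = Pi.single q a)
    (h₂ : LinearMap.lsum k (fun _ : Q => A) k s ∘ₗ F = LinearMap.id) : M ≃ₗ[k] (Q → A) :=
  LinearEquiv.ofLinearMap F (LinearMap.lsum k (fun _ : Q => A) k s)
    (LinearMap.pi_ext' fun q => LinearMap.ext fun a => by
      change F (LinearMap.lsum k (fun _ : Q => A) k s (Pi.single q a)) = Pi.single q a
      rw [LinearMap.lsum_piSingle, h₁]) h₂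

/-- The embedding of the `q`-th copy of `A` into an induced representation. -/
noncomputable def indSection (ρ : Representation k (Q → D) A) (q : Q) :
    A →ₗ[k] Representation.IndV (baseHom : (Q → D) →* D ≀ᵣ Q) ρ :=
  Representation.IndV.mk (baseHom : (Q → D) →* D ≀ᵣ Q) ρ (⟨1, q⟩ : D ≀ᵣ Q)

/-- A representation of `D ≀ Q` induced from `ρ` on the base group has a direct sum of copies of the
space of `ρ`, indexed by `Q`, as underlying space. -/
noncomputable def indBaseEquiv [Fintype Q] [DecidableEq Q] (ρ : Representation k (Q → D) A) :
    Representation.IndV baseHom ρ ≃ₗ[k] (Q → A) :=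
  equivPiOfSections (indBaseMap ρ)
    (indSection ρ)
    (fun q a => by
      rw [indSection, indBaseMap_mk]
      simp)
    (Representation.IndV.hom_ext _ _ fun h => LinearMap.ext fun a => by
      rw [LinearMap.comp_apply, LinearMap.comp_apply, indBaseMap_mk, LinearMap.lsum_piSingle,
        LinearMap.id_comp, indSection, ← indV_mk_eq])

theorem indBaseEquiv_mk [Fintype Q] [DecidableEq Q] (ρ : Representation k (Q → D) A) (h : D ≀ᵣ Q)
    (a : A) : indBaseEquiv ρ (Representation.IndV.mk baseHom ρ h a) =
      Pi.single h.right (ρ h.left⁻¹ a) :=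
  indBaseMap_mk ρ h a

theorem indBaseEquiv_symm_single [Fintype Q] [DecidableEq Q] (ρ : Representation k (Q → D) A)
    (q : Q) (a : A) : (indBaseEquiv ρ).symm (Pi.single q a) =
      Representation.IndV.mk baseHom ρ (⟨1, q⟩ : D ≀ᵣ Q) a :=
  (indBaseEquiv ρ).injective <| by
    rw [LinearEquiv.apply_symm_apply, indBaseEquiv_mk]
    simp

/-- The trace of an element of `D ≀ Q` on a representation induced from the base group. -/
theorem trace_ind_baseHom [Fintype Q] [DecidableEq Q] [Module.Free k A] [Module.Finite k A]
    (ρ : Representation k (Q → D) A) (w : D ≀ᵣ Q) :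
    LinearMap.trace k _ (Representation.ind baseHom ρ w) =
      if w.right = 1 then ∑ q : Q, LinearMap.trace k A (ρ (fun i => w.left (q⁻¹ * i))) else 0 := by
  -- The summand at `q` is carried to the one at `q * w.right⁻¹`, so diagonal blocks occur only when
  -- `w.right = 1`.
  have hT : ∀ q a, (indBaseEquiv ρ).conj (Representation.ind baseHom ρ w) (Pi.single q a) =
      Pi.single (q * w.right⁻¹) (ρ (fun i => w.left (w.right * (q⁻¹ * i))) a) := by
    intro q a
    rw [LinearEquiv.conj_apply_apply, indBaseEquiv_symm_single, Representation.ind_mk,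
      indBaseEquiv_mk]
    congr 3
    funext i
    simp
  let b := Module.Free.chooseBasis k A
  rw [← LinearMap.trace_conj' _ (indBaseEquiv ρ),
    LinearMap.trace_eq_matrix_trace k (Pi.basis fun _ : Q => b), Matrix.trace,
    Fintype.sum_sigma]
  simp only [Matrix.diag_apply, LinearMap.toMatrix_apply, Pi.basis_apply, hT, Pi.basis_repr]
  split_ifs with h
  · refine Finset.sum_congr rfl fun q _ => ?_
    rw [LinearMap.trace_eq_matrix_trace k b, Matrix.trace]
    simp [h, LinearMap.toMatrix_apply]
  · refine Finset.sum_eq_zero fun q _ => Finset.sum_eq_zero fun i _ => ?_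
    rw [Pi.single_eq_of_ne (by simpa using h)]
    simp

end Induction

theorem ind_baseHom_character {D Q A : Type} [Group D] [Group Q] [AddCommGroup A] [Module ℂ A]
    [Fintype Q] [DecidableEq Q] [Module.Finite ℂ A] (ρ : Representation ℂ (Q → D) A) (w : D ≀ᵣ Q) :
    (Representation.ind baseHom ρ).character w =
      if w.right = 1 then ∑ q : Q, ρ.character (fun i => w.left (q⁻¹ * i)) else 0 :=
  trace_ind_baseHom ρ w

instance finite_indV {D Q A : Type} [Group D] [Group Q] [AddCommGroup A] [Module ℂ A]
    [Finite Q] [Module.Finite ℂ A] (ρ : Representation ℂ (Q → D) A) :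
    Module.Finite ℂ (Representation.IndV baseHom ρ) := by
  classical
  have := Fintype.ofFinite Q
  exact Module.Finite.equiv (indBaseEquiv ρ).symm

section Tensor

/-- The character of an outer tensor product is the product of the characters. -/
theorem outerTensor_character {D Q : Type} [Group D] [Fintype Q] {V : Q → Type}
    [∀ i, AddCommGroup (V i)]
    [∀ i, Module ℂ (V i)] [∀ i, Module.Finite ℂ (V i)] (ρ : ∀ i, Representation ℂ D (V i))
    (f : Q → D) : (outerTensor ρ).character f = ∏ i, (ρ i).character (f i) := by
  classical
  let b := fun i => Module.finBasis ℂ (V i)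
  simp only [Representation.character]
  rw [LinearMap.trace_eq_matrix_trace ℂ (Basis.piTensorProduct b), Matrix.trace]
  simp only [fun i => LinearMap.trace_eq_matrix_trace ℂ (b i), Matrix.trace, Finset.prod_univ_sum,
    Fintype.piFinset_univ]
  refine Finset.sum_congr rfl fun p _ => ?_
  simp [LinearMap.toMatrix_apply, outerTensor]

/-- A representation on a line is trivial. -/
structure IsTrivialLine {G V : Type} [Group G] [AddCommGroup V] [Module ℂ V]
    (ρ : Representation ℂ G V) : Prop where
  finrank : Module.finrank ℂ V = 1
  apply : ∀ g, ρ g = 1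

theorem finrank_tensorPower {Q : Type} [Finite Q] {V : Type} [AddCommGroup V] [Module ℂ V]
    (hV : Module.finrank ℂ V = 1) : Module.finrank ℂ (⨂[ℂ] _ : Q, V) = 1 := by
  have := Module.finite_of_finrank_eq_succ hV
  have := Fintype.ofFinite Q
  classical
  rw [Module.finrank_eq_card_basis (Basis.piTensorProduct fun _ : Q => Module.finBasis ℂ V)]
  simp [hV]

/-- Over a line every pure tensor is a multiple of e ⊗ ⋯ ⊗ e, which permuting the factors fixes.
Only the inflated character `ψ` remains. -/
theorem extendedTensor_apply_of_isTrivialLine {D Q : Type} [Group D] [Group Q] [Finite Q]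
    {V : Type} [AddCommGroup V] [Module ℂ V]
    {ρ : Representation ℂ D V} (hρ : IsTrivialLine ρ) (ψ : Q →* ℂ) (w : D ≀ᵣ Q) :
    extendedTensor ρ ψ w = ψ w.right • 1 := by
  have := Fintype.ofFinite Q
  obtain ⟨e, -, he⟩ := finrank_eq_one_iff'.1 hρ.finrank
  change ψ w.right • tensorPower ρ w = _
  congr 1
  ext v
  choose c hc using fun i => he (v i)
  obtain rfl : v = fun i => c i • e := funext fun i => (hc i).symm
  simp only [LinearMap.compMultilinearMap_apply, tensorPower, MonoidHom.coe_mk, OneHom.coe_mk,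
    LinearMap.comp_apply, LinearEquiv.coe_coe, PiTensorProduct.reindex_tprod,
    PiTensorProduct.map_tprod, hρ.apply, Module.End.one_apply, MultilinearMap.map_smul_univ]

theorem extendedTensor_character_of_isTrivialLine {D Q : Type} [Group D] [Group Q] [Finite Q]
    {V : Type} [AddCommGroup V]
    [Module ℂ V] {ρ : Representation ℂ D V} (hρ : IsTrivialLine ρ) (ψ : Q →* ℂ) (w : D ≀ᵣ Q) :
    (extendedTensor ρ ψ).character w = ψ w.right := by
  have := Module.finite_of_finrank_eq_succ hρ.finrank
  rw [Representation.character, extendedTensor_apply_of_isTrivialLine hρ, map_smul,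
    LinearMap.trace_one, finrank_tensorPower hρ.finrank]
  simp

end Tensor

end CharacterFormulas

/-! ### Recursive formulas for the characters of labelling functions -/

section TreeCharacters

theorem treeRep_eq_of_eq_last (p : ℕ) [Fact p.Prime] (k : ℕ) {t : Labelling p}
    (ht : t [] = Fin.last p) : treeRep p (k + 1) t =
      Rep.of ((Representation.ind baseHom
        (outerTensor fun i : Cyc p => (treeRep p k (t.sub i.toAdd)).ρ)).comp
        (wrSucc p k).toMonoidHom) := by
  rw [treeRep, if_pos ht]

theorem treeRep_eq_of_ne_last (p : ℕ) [Fact p.Prime] (k : ℕ) {t : Labelling p}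
    (ht : t [] ≠ Fin.last p) : treeRep p (k + 1) t =
      Rep.of ((extendedTensor (treeRep p k (t.sub 1)).ρ (phi p ((t [] : ℕ) : ZMod p))).comp
        (wrSucc p k).toMonoidHom) := by
  rw [treeRep, if_neg ht]

instance finite_treeRep (p : ℕ) [Fact p.Prime] (k : ℕ) (t : Labelling p) :
    Module.Finite ℂ (treeRep p k t) := by
  induction k generalizing t with
  | zero => exact inferInstanceAs (Module.Finite ℂ ℂ)
  | succ k ih =>
    by_cases ht : t [] = Fin.last p
    · have := fun i : Cyc p => ih (t.sub i.toAdd)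
      rw [treeRep_eq_of_eq_last p k ht]
      exact finite_indV (Q := Cyc p)
        (outerTensor fun i : Cyc p => (treeRep p k (t.sub i.toAdd)).ρ)
    · have := ih (t.sub 1)
      rw [treeRep_eq_of_ne_last p k ht]
      exact inferInstanceAs (Module.Finite ℂ (⨂[ℂ] _ : Cyc p, treeRep p k (t.sub 1)))

/-- The function on `D ≀ Q` induced from the product function `f ↦ ∏ i, θ i (f i)` on the base
group. -/
noncomputable def indFun {D Q : Type} [Group D] [Group Q] [Fintype Q] [DecidableEq Q]
    (θ : Q → D → ℂ) (w : D ≀ᵣ Q) : ℂ :=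
  if w.right = 1 then ∑ q : Q, ∏ i : Q, θ (q * i) (w.left i) else 0

theorem treeRep_character_of_eq_last (p : ℕ) [Fact p.Prime] (k : ℕ) {t : Labelling p}
    (ht : t [] = Fin.last p) (w : Wr p (k + 1)) : (treeRep p (k + 1) t).ρ.character w =
      indFun (fun (i : Cyc p) (d : Wr p k) => (treeRep p k (t.sub i.toAdd)).ρ.character d)
        (wrSucc p k w) := by
  rw [treeRep_eq_of_eq_last p k ht]
  refine (ind_baseHom_character
    (outerTensor fun i : Cyc p => (treeRep p k (t.sub i.toAdd)).ρ) (wrSucc p k w)).trans ?_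
  rw [indFun]
  refine if_congr Iff.rfl (Finset.sum_congr rfl fun q _ => ?_) rfl
  -- Substituting q * i for i moves the translation from the group element to the family of
  -- characters.
  rw [outerTensor_character, ← Equiv.prod_comp (Equiv.mulLeft q)]
  simp
  rfl

theorem treeRep_character_of_ne_last (p : ℕ) [Fact p.Prime] (k : ℕ) {t : Labelling p}
    (ht : t [] ≠ Fin.last p) (h : IsTrivialLine (treeRep p k (t.sub 1)).ρ) (w : Wr p (k + 1)) :
    (treeRep p (k + 1) t).ρ.character w =
      phi p ((t [] : ℕ) : ZMod p) (wrSucc p k w).right := by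
  rw [treeRep_eq_of_ne_last p k ht]
  exact extendedTensor_character_of_isTrivialLine h _ (wrSucc p k w)

theorem phi_apply (p : ℕ) [Fact p.Prime] (ε : ZMod p) (c : Cyc p) :
    phi p ε c = ZMod.stdAddChar (ε * c.toAdd) := rfl

theorem isTrivialLine_treeRep_zero (p : ℕ) [Fact p.Prime] (t : Labelling p) :
    IsTrivialLine (treeRep p 0 t).ρ :=
  ⟨Module.finrank_self ℂ, fun _ => rfl⟩

theorem isTrivialLine_treeRep_succ (p : ℕ) [Fact p.Prime] (k : ℕ) {t : Labelling p}
    (ht : t [] = 0) (h : IsTrivialLine (treeRep p k (t.sub 1)).ρ) :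
    IsTrivialLine (treeRep p (k + 1) t).ρ := by
  have ht' : t [] ≠ Fin.last p := by
    rw [ht]
    exact (Fin.last_pos' (n := p)).ne
  rw [treeRep_eq_of_ne_last p k ht']
  refine ⟨finrank_tensorPower h.finrank, fun w => ?_⟩
  refine (extendedTensor_apply_of_isTrivialLine h _ (wrSucc p k w)).trans ?_
  rw [ht, phi_apply]
  simp

end TreeCharacters

/-! ### Orthogonality relations on wreath products -/

section Orthogonality

variable {D Q : Type} [Group D] [Group Q] [Fintype Q] [DecidableEq Q]

theorem sum_wreath {D Q : Type} [Fintype Q] [DecidableEq Q] [Fintype D]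
    [Fintype (D ≀ᵣ Q)] (F : D ≀ᵣ Q → ℂ) :
    ∑ w, F w = ∑ h : Q, ∑ f : Q → D, F ⟨f, h⟩ := by
  rw [Finset.sum_comm, ← Fintype.sum_prod_type']
  exact Fintype.sum_equiv (RegularWreathProduct.equivProd D Q) _ _ fun _ => rfl

theorem indFun_base (θ : Q → D → ℂ) (f : Q → D) :
    indFun θ ⟨f, 1⟩ = ∑ q : Q, ∏ i : Q, θ (q * i) (f i) := if_pos rfl

theorem indFun_of_ne_one (θ : Q → D → ℂ) {w : D ≀ᵣ Q} (hw : w.right ≠ 1) : indFun θ w = 0 :=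
  if_neg hw

theorem inv_base {D Q : Type} [Group D] [Group Q] (f : Q → D) : (⟨f, 1⟩ : D ≀ᵣ Q)⁻¹ = ⟨f⁻¹, 1⟩ := by
  ext <;> simp

/-- Only the base group contributes. There the sum splits over pairs of translates (q, r) into
products of inner products over `D`. One vanishing factor kills each pair with q ≠ r, and the |Q|
diagonal pairs contribute |D|^|Q| each. -/
theorem sum_indFun_mul_inv [Fintype D] [Fintype (D ≀ᵣ Q)] (θ : Q → D → ℂ)
    (hnorm : ∀ i, ∑ d, θ i d * θ i d⁻¹ = Nat.card D)
    (horth : ∀ q r, q ≠ r → ∃ i, ∑ d, θ (q * i) d * θ (r * i) d⁻¹ = 0) :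
    ∑ w : D ≀ᵣ Q, indFun θ w * indFun θ w⁻¹ = Nat.card (D ≀ᵣ Q) := by
  rw [sum_wreath, Finset.sum_eq_single 1]
  · have key : ∀ q r : Q, ∑ f : Q → D, (∏ i, θ (q * i) (f i)) * ∏ i, θ (r * i) (f i)⁻¹ =
        if q = r then (Nat.card D : ℂ) ^ Nat.card Q else 0 := by
      intro q r
      simp only [← Finset.prod_mul_distrib]
      rw [← Fintype.piFinset_univ, ← Finset.prod_univ_sum (fun _ => Finset.univ)
        fun i d => θ (q * i) d * θ (r * i) d⁻¹]
      split_ifs with h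
      · subst h
        simp [hnorm]
      · obtain ⟨i, hi⟩ := horth q r h
        exact Finset.prod_eq_zero (Finset.mem_univ i) hi
    simp only [inv_base, indFun_base, Finset.sum_mul_sum, Pi.inv_apply]
    rw [Finset.sum_comm]
    simp only [Finset.sum_comm (γ := Q → D), key]
    rw [RegularWreathProduct.card]
    simp [mul_comm]
  · intro h _ hh
    exact Finset.sum_eq_zero fun f _ => by rw [indFun_of_ne_one θ hh, zero_mul]
  · simp

/-- The inflation of `ψ` is trivial on the base group, which supports `indFun θ`. Each translate
then contains the vanishing factor at `i`. -/
theorem sum_indFun_mul_right [Fintype D] [Fintype (D ≀ᵣ Q)] (θ : Q → D → ℂ) (ψ : Q →* ℂ)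
    (i : Q) (hi : ∑ d, θ i d = 0) : ∑ w : D ≀ᵣ Q, indFun θ w * ψ (w⁻¹).right = 0 := by
  rw [sum_wreath, Finset.sum_eq_single 1]
  · simp only [inv_base, indFun_base, map_one, mul_one]
    rw [Finset.sum_comm]
    refine Finset.sum_eq_zero fun q _ => ?_
    rw [← Fintype.piFinset_univ, ← Finset.prod_univ_sum (fun _ => Finset.univ)
        fun i d => θ (q * i) d]
    exact Finset.prod_eq_zero (Finset.mem_univ (q⁻¹ * i)) (by simpa using hi)
  · intro h _ hh
    exact Finset.sum_eq_zero fun f _ => by rw [indFun_of_ne_one θ hh, zero_mul]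
  · simp

theorem sum_phi_right {D : Type} [Group D] {p : ℕ} [Fact p.Prime] [Fintype (D ≀ᵣ Cyc p)]
    {ε : ZMod p} (hε : ε ≠ 0) : ∑ w : D ≀ᵣ Cyc p, phi p ε w.right = 0 := by
  refine sum_hom_units_eq_zero ((phi p ε).comp RegularWreathProduct.rightHom) fun h => hε ?_
  have := DFunLike.congr_fun h (RegularWreathProduct.inl (Multiplicative.ofAdd 1))
  have h1 : (ZMod.stdAddChar ε : ℂ) = ZMod.stdAddChar (0 : ZMod p) := by
    simpa [phi_apply] using this
  exact ZMod.injective_stdAddChar h1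

theorem sum_phi_right_mul_inv {D : Type} [Group D] {p : ℕ} [Fact p.Prime]
    [Fintype (D ≀ᵣ Cyc p)] (ε δ : ZMod p) :
    ∑ w : D ≀ᵣ Cyc p, phi p ε w.right * phi p δ (w⁻¹).right =
      if ε = δ then (Nat.card (D ≀ᵣ Cyc p) : ℂ) else 0 := by
  have h : ∀ w : D ≀ᵣ Cyc p, phi p ε w.right * phi p δ (w⁻¹).right = phi p (ε - δ) w.right := by
    intro w
    simp only [phi_apply, RegularWreathProduct.inv_right, toAdd_inv, ← AddChar.map_add_eq_mul]
    congr 1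
    ring
  simp only [h]
  split_ifs with hε
  · simp [hε, phi_apply]
  · exact sum_phi_right (sub_ne_zero.2 hε)

end Orthogonality

/-! ### Power maps and induction to the symmetric group -/

section InducedFunctions

/-- A power of a cycle prime to its order is a cycle with the same support, and powers of disjoint
permutations stay disjoint. -/
theorem cycleType_pow_of_coprime {α : Type} [Fintype α] [DecidableEq α] (m : ℕ)
    (g : Equiv.Perm α) (h : m.Coprime (orderOf g)) : (g ^ m).cycleType = g.cycleType := by
  induction g using Equiv.Perm.cycle_induction_on with
  | base_one => simp
  | base_cycles σ hσ =>
    rw [hσ.cycleType, (hσ.pow_iff.2 h).cycleType, Equiv.Perm.support_pow_coprime h]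
  | induction_disjoint σ τ hd _ hσ hτ =>
    rw [hd.orderOf] at h
    rw [hd.commute.mul_pow, (hd.pow_disjoint_pow m m).cycleType_mul, hd.cycleType_mul,
      hσ (h.coprime_dvd_right (Nat.dvd_lcm_left _ _)),
      hτ (h.coprime_dvd_right (Nat.dvd_lcm_right _ _))]

/-- If some conjugate of g lies in `P`, then g has p-power order and c g c⁻¹ = g ^ m for some c.
Translating the summation variable by c turns x g x⁻¹ into its m-th power. If no conjugate lies in
`P`, both sums vanish. -/
theorem inducedFun_eq_of_pow {α : Type} [Finite α] {p m : ℕ} [Fact p.Prime]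
    (hm : m.Coprime p) {P : Subgroup (Equiv.Perm α)} (hP : IsPGroup p P) {χ χ' : ↥P → ℂ}
    (h : ∀ x, χ' x = χ (x ^ m)) : inducedFun χ = inducedFun χ' := by
  classical
  have := Fintype.ofFinite α
  funext g
  unfold inducedFun
  congr 1
  by_cases hg : ∃ y : Equiv.Perm α, y * g * y⁻¹ ∈ P
  · obtain ⟨y, hy⟩ := hg
    have hord : m.Coprime (orderOf g) := by
      obtain ⟨k, hk⟩ := (IsPGroup.iff_orderOf.1 hP) ⟨_, hy⟩
      rw [Subgroup.orderOf_mk] at hk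
      have h1 : orderOf (MulAut.conj y g) = orderOf g := MulEquiv.orderOf_eq _ _
      rw [MulAut.conj_apply] at h1
      rw [← h1, hk]
      exact hm.pow_right k
    obtain ⟨c, hc⟩ := isConj_iff.1 (Equiv.Perm.isConj_of_cycleType_eq
      (cycleType_pow_of_coprime m g hord).symm)
    -- Some power of g ^ m is g again, so a conjugate of g lies in `P` exactly when its m-th power
    -- does.
    obtain ⟨k, hk⟩ := exists_pow_eq_self_of_coprime hord
    rw [← finsum_comp_equiv (Equiv.mulRight c)]
    refine finsum_congr fun x => ?_
    have hx : Equiv.mulRight c x * g * (Equiv.mulRight c x)⁻¹ = (x * g * x⁻¹) ^ m := by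
      rw [conj_pow, ← hc]
      simp [mul_assoc]
    have hmem : (x * g * x⁻¹) ^ m ∈ P ↔ x * g * x⁻¹ ∈ P := by
      refine ⟨fun h => ?_, fun h => P.pow_mem h m⟩
      have := P.pow_mem h k
      rwa [conj_pow, conj_pow, hk] at this
    by_cases hxP : x * g * x⁻¹ ∈ P
    · rw [dif_pos hxP, dif_pos (by rw [hx]; exact hmem.2 hxP), h]
      congr 1
      exact Subtype.ext hx
    · rw [dif_neg hxP, dif_neg (by rw [hx]; exact fun h => hxP (hmem.1 h))]
  · push Not at hg
    simp only [dif_neg (hg _)]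

theorem wreath_pow_right {D Q : Type} [Group D] [Group Q] (w : D ≀ᵣ Q) (m : ℕ) :
    (w ^ m).right = w.right ^ m :=
  map_pow RegularWreathProduct.rightHom w m

/-- The hypothesis on `Q` keeps elements outside the base group outside it after taking m-th powers;
on the base group powers are coordinatewise. -/
theorem indFun_pow {D Q : Type} [Group D] [Group Q] [Fintype Q] [DecidableEq Q] {m : ℕ}
    (hm : ∀ h : Q, h ^ m = 1 → h = 1) {θ θ' : Q → D → ℂ} (h : ∀ i d, θ' i d = θ i (d ^ m))
    (w : D ≀ᵣ Q) : indFun θ' w = indFun θ (w ^ m) := by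
  by_cases hw : w.right = 1
  · obtain ⟨f, q⟩ := w
    obtain rfl : q = 1 := hw
    have hf : (⟨f, 1⟩ : D ≀ᵣ Q) ^ m = ⟨f ^ m, 1⟩ := (map_pow (baseHom (Q := Q)) f m).symm
    rw [hf, indFun_base, indFun_base]
    simp only [h, Pi.pow_apply]
  · rw [indFun_of_ne_one _ hw, indFun_of_ne_one]
    rw [wreath_pow_right]
    exact fun h1 => hw (hm _ h1)

end InducedFunctions

/-! ### The two characters as members of one family -/

section Example

/-- The labels, up to a scalar, of the children of the first child of the root. -/
def leafLabel (j : Cyc 5) : ZMod 5 :=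
  if j.toAdd = 3 ∨ j.toAdd = 4 ∨ j.toAdd = 0 then 1 else 0

/-- The labels, up to a scalar, of the children of the root other than the first. -/
def midLabel (i : Cyc 5) : ZMod 5 :=
  if i.toAdd = 3 then 1 else if i.toAdd = 4 then 2 else if i.toAdd = 0 then 3 else 0

/-- The character of degree `5` of `P_25` at the first child of the root. -/
noncomputable def innerChar (u : ZMod 5) (d : Wr 5 2) : ℂ :=
  indFun (fun (j : Cyc 5) (e : Wr 5 1) => phi 5 (u * leafLabel j) (wrSucc 5 0 e).right)
    (wrSucc 5 1 d)

/-- The character of `P_25` at the `i`-th child of the root. -/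
noncomputable def childChar (u : ZMod 5) (i : Cyc 5) (d : Wr 5 2) : ℂ :=
  if i.toAdd = 1 then innerChar u d else phi 5 (u * midLabel i) (wrSucc 5 1 d).right

/-- The character of `P_125` of the labelling function whose labels are those of the example,
multiplied by `u`. -/
noncomputable def rootChar (u : ZMod 5) (w : Wr 5 3) : ℂ :=
  indFun (childChar u) (wrSucc 5 2 w)

/-- Below a vertex with label less than 5 only the first child enters `treeRep`, so `t [i, 1] = 0`
is enough to make the tensor power there trivial and leave an inflated linear character. -/
theorem treeRep_character_eq_rootChar (u : ZMod 5) (t : Labelling 5) (h₀ : t [] = Fin.last 5)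
    (h₁ : t [1] = Fin.last 5)
    (hleaf : ∀ j, t [1, j] ≠ Fin.last 5 ∧
      ((t [1, j] : ℕ) : ZMod 5) = u * leafLabel (Multiplicative.ofAdd j))
    (hmid : ∀ i, i ≠ 1 → t [i] ≠ Fin.last 5 ∧ t [i, 1] = 0 ∧
      ((t [i] : ℕ) : ZMod 5) = u * midLabel (Multiplicative.ofAdd i))
    (w : Wr 5 3) : (treeRep 5 3 t).ρ.character w = rootChar u w := by
  rw [treeRep_character_of_eq_last 5 2 h₀, rootChar]
  congr 1
  funext i d
  rw [childChar]
  split_ifs with hi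
  · rw [hi, treeRep_character_of_eq_last 5 1 h₁, innerChar]
    congr 1
    funext j e
    rw [treeRep_character_of_ne_last 5 0 (t := (t.sub 1).sub j.toAdd) (hleaf _).1
      (isTrivialLine_treeRep_zero 5 _)]
    congr 1
    exact congrArg (phi 5) (hleaf j.toAdd).2
  · rw [treeRep_character_of_ne_last 5 1 (t := t.sub i.toAdd) (hmid _ hi).1
      (isTrivialLine_treeRep_succ 5 0 (t := (t.sub i.toAdd).sub 1) (hmid _ hi).2.1
        (isTrivialLine_treeRep_zero 5 _))]
    congr 1
    exact congrArg (phi 5) (hmid i.toAdd hi).2.2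

theorem treeChar_t₁ (x : ↥(sylowWr 5 3)) :
    treeChar 5 3 t₁ x = rootChar 1 (sylowEquiv 5 3 x) :=
  treeRep_character_eq_rootChar 1 t₁ (by decide) (by decide) (by decide) (by decide) _

theorem treeChar_t₂ (x : ↥(sylowWr 5 3)) :
    treeChar 5 3 t₂ x = rootChar 3 (sylowEquiv 5 3 x) :=
  treeRep_character_eq_rootChar 3 t₂ (by decide) (by decide) (by decide) (by decide) _

/-- Equivalence of labelling functions is decidable. -/
@[reducible]
def decidableTreeEquiv {p : ℕ} [NeZero p] : ∀ (k : ℕ) (t t' : Labelling p),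
    Decidable (TreeEquiv k t t')
  | 0, _, _ => isTrue trivial
  | k + 1, t, t' =>
    have := fun i c => decidableTreeEquiv k (t.sub i) (t'.sub (i + c))
    inferInstanceAs (Decidable (t [] = t' [] ∧ ∃ c : ZMod p, ∀ i,
      TreeEquiv k (t.sub i) (t'.sub (i + c))))

/-- Admissibility of labelling functions is decidable. -/
@[reducible]
def decidableAdmissible {p : ℕ} [NeZero p] : ∀ (k : ℕ) (t : Labelling p),
    Decidable (Admissible k t)
  | 0, _ => isTrue trivial
  | k + 1, t =>
    have := fun i => decidableAdmissible k (t.sub i)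
    have := fun i j => decidableTreeEquiv k (t.sub i) (t.sub j)
    inferInstanceAs (Decidable ((∀ i, Admissible k (t.sub i)) ∧
      (t [] ≠ Fin.last p ↔ ∀ i j, TreeEquiv k (t.sub i) (t.sub j))))

attribute [local instance] decidableAdmissible

set_option maxRecDepth 10000 in
theorem admissible_t₁ : Admissible 3 t₁ := by decide +kernel

set_option maxRecDepth 10000 in
theorem admissible_t₂ : Admissible 3 t₂ := by decide +kernel

theorem phi_mul_apply (m : ℕ) (ε : ZMod 5) (c : Cyc 5) :
    phi 5 (m * ε) c = phi 5 ε (c ^ m) := by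
  rw [phi_apply, phi_apply, toAdd_pow, nsmul_eq_mul]
  congr 1
  ring

theorem innerChar_pow (d : Wr 5 2) : innerChar 3 d = innerChar 1 (d ^ 3) := by
  rw [innerChar, innerChar, map_pow]
  refine indFun_pow (by decide) (fun j e => ?_) _
  rw [map_pow, wreath_pow_right, one_mul]
  exact phi_mul_apply 3 _ _

/-- Cubing is injective on the cyclic group of order 5, so `indFun_pow` applies at both induced
levels, and multiplying a linear label by 3 amounts to cubing the argument. -/
theorem rootChar_pow (w : Wr 5 3) : rootChar 3 w = rootChar 1 (w ^ 3) := by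
  rw [rootChar, rootChar, map_pow]
  refine indFun_pow (by decide) (fun i d => ?_) _
  rw [childChar, childChar, innerChar_pow]
  split_ifs
  · rfl
  · rw [map_pow, wreath_pow_right, one_mul]
    exact phi_mul_apply 3 _ _

theorem inducedFun_treeChar_eq :
    inducedFun (treeChar 5 3 t₁) = inducedFun (treeChar 5 3 t₂) := by
  refine inducedFun_eq_of_pow (p := 5) (m := 3) (by norm_num) (sylowWr 5 3).isPGroup' fun x => ?_
  rw [treeChar_t₁, treeChar_t₂, map_pow, rootChar_pow]

theorem innerChar_one (u : ZMod 5) : innerChar u 1 = 5 := by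
  rw [innerChar, map_one, show (1 : Wr 5 1 ≀ᵣ Cyc 5) = ⟨1, 1⟩ from rfl, indFun_base]
  have h : ∀ ε j, phi 5 ε (wrSucc 5 0 ((1 : Cyc 5 → Wr 5 1) j)).right = 1 :=
    fun ε _ => map_one (phi 5 ε)
  simp only [h]
  simp

theorem rootChar_one (u : ZMod 5) : rootChar u 1 = 25 := by
  have h : ∀ i, childChar u i 1 = if i = Multiplicative.ofAdd 1 then 5 else 1 := by
    intro i
    rw [childChar, innerChar_one, map_one]
    exact if_congr Iff.rfl rfl (map_one _)
  rw [rootChar, map_one, show (1 : Wr 5 2 ≀ᵣ Cyc 5) = ⟨1, 1⟩ from rfl, indFun_base]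
  simp only [Pi.one_apply, h]
  simp [← eq_inv_mul_iff_mul_eq]
  norm_num

end Example

/-! ### Irreducibility by the norm criterion -/

section Irreducibility

theorem sum_wrSucc {p k : ℕ} [Fintype (Wr p (k + 1))] [Fintype (Wr p k ≀ᵣ Cyc p)]
    (F : Wr p k ≀ᵣ Cyc p → ℂ) : ∑ d : Wr p (k + 1), F (wrSucc p k d) = ∑ w, F w :=
  Fintype.sum_equiv (wrSucc p k).toEquiv _ _ fun _ => rfl

noncomputable instance (p k : ℕ) [NeZero p] : Fintype (Wr p k) := Fintype.ofFinite _

noncomputable instance (p k : ℕ) [NeZero p] : Fintype (Wr p k ≀ᵣ Cyc p) := Fintype.ofFinite _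

theorem leafChar_mul_inv (ε δ : ZMod 5) :
    ∑ e : Wr 5 1, phi 5 ε (wrSucc 5 0 e).right * phi 5 δ (wrSucc 5 0 e⁻¹).right =
      if ε = δ then (Nat.card (Wr 5 1) : ℂ) else 0 := by
  simp only [map_inv]
  exact (sum_wrSucc _).trans (sum_phi_right_mul_inv ε δ)

theorem midChar_mul_inv (ε δ : ZMod 5) :
    ∑ e : Wr 5 2, phi 5 ε (wrSucc 5 1 e).right * phi 5 δ (wrSucc 5 1 e⁻¹).right =
      if ε = δ then (Nat.card (Wr 5 2) : ℂ) else 0 := by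
  simp only [map_inv]
  exact (sum_wrSucc _).trans (sum_phi_right_mul_inv ε δ)

theorem innerChar_mul_inv {u : ZMod 5} (hu : u ≠ 0) :
    ∑ d : Wr 5 2, innerChar u d * innerChar u d⁻¹ = Nat.card (Wr 5 2) := by
  simp only [innerChar, map_inv]
  refine (sum_wrSucc (k := 1) fun w => indFun _ w * indFun _ w⁻¹).trans
    (sum_indFun_mul_inv _ (fun j => ?_) fun q r hqr => ?_)
  · rw [leafChar_mul_inv, if_pos rfl]
  -- No nontrivial rotation fixes the pattern of leaf labels, whose support is {3, 4, 0}.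
  · have : ∀ q r : Cyc 5, q ≠ r → ∃ j, leafLabel (q * j) ≠ leafLabel (r * j) := by decide
    obtain ⟨j, hj⟩ := this q r hqr
    refine ⟨j, ?_⟩
    rw [leafChar_mul_inv, if_neg]
    exact fun h => hj (mul_left_cancel₀ hu h)

/-- The nontrivial leaf label at child 3 supplies the factor whose sum is zero. -/
theorem innerChar_mul_phi_inv {u : ZMod 5} (hu : u ≠ 0) (ε : ZMod 5) :
    ∑ d : Wr 5 2, innerChar u d * phi 5 ε (wrSucc 5 1 d⁻¹).right = 0 := by
  simp only [innerChar, map_inv]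
  refine (sum_wrSucc (k := 1) fun w => indFun _ w * phi 5 ε w⁻¹.right).trans
    (sum_indFun_mul_right _ (phi 5 ε) (Multiplicative.ofAdd 3) ?_)
  have h : u * leafLabel (Multiplicative.ofAdd 3) ≠ 0 := mul_ne_zero hu (by decide)
  exact (sum_wrSucc (k := 0) fun w => phi 5 _ w.right).trans (sum_phi_right h)

theorem rootChar_mul_inv {u : ZMod 5} (hu : u ≠ 0) :
    ∑ w : Wr 5 3, rootChar u w * rootChar u w⁻¹ = Nat.card (Wr 5 3) := by
  simp only [rootChar, map_inv]
  refine (sum_wrSucc (k := 2) fun w => indFun (childChar u) w * indFun (childChar u) w⁻¹).trans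
    -- At this position the q-translate has the character of degree 5 and the r-translate a linear
    -- one; these are orthogonal.
    (sum_indFun_mul_inv _ (fun i => ?_) fun q r hqr => ⟨q⁻¹ * Multiplicative.ofAdd 1, ?_⟩)
  · by_cases hi : i.toAdd = 1
    · simp only [childChar, if_pos hi, innerChar_mul_inv hu]
    · simp only [childChar, if_neg hi, midChar_mul_inv, if_true]
  · have h1 : (q * (q⁻¹ * Multiplicative.ofAdd 1)).toAdd = 1 := by simp
    have h2 : (r * (q⁻¹ * Multiplicative.ofAdd (1 : ZMod 5))).toAdd ≠ 1 := by
      intro h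
      apply hqr
      have := Multiplicative.toAdd.injective (h.trans h1.symm)
      exact (mul_right_cancel this).symm
    simp only [childChar, if_pos h1, if_neg h2, innerChar_mul_phi_inv hu]

theorem isIrrChar_treeChar {u : ZMod 5} (hu : u ≠ 0) {t : Labelling 5}
    (ht : ∀ x, treeChar 5 3 t x = rootChar u (sylowEquiv 5 3 x)) :
    IsIrrChar (treeChar 5 3 t) := by
  have := Fintype.ofFinite ↥(sylowWr 5 3)
  let V : FDRep ℂ ↥(sylowWr 5 3) :=
    FDRep.of ((treeRep 5 3 t).ρ.comp (sylowEquiv 5 3).toMonoidHom)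
  have hV : V.character = treeChar 5 3 t := rfl
  refine ⟨V, (FDRep.simple_iff_char_is_norm_one V).2 ?_, hV⟩
  simp only [hV, ht, map_inv]
  refine (Fintype.sum_equiv (sylowEquiv 5 3).toEquiv _
    (fun w => rootChar u w * rootChar u w⁻¹) fun _ => rfl).trans ?_
  rw [rootChar_mul_inv hu, Nat.card_congr (sylowEquiv 5 3).toEquiv]

end Irreducibility

/-! ### The Galois action on character values -/

section GaloisAction

theorem isPrimitiveRoot_omega (p : ℕ) [hp : Fact p.Prime] : IsPrimitiveRoot (omega p) p :=
  Complex.isPrimitiveRoot_exp p hp.out.ne_zero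

theorem isPrimitiveRoot_omegaK (p : ℕ) [hp : Fact p.Prime] : IsPrimitiveRoot (omegaK p) p :=
  IsPrimitiveRoot.of_map_of_injective (f := (cycField p).val) (isPrimitiveRoot_omega p)
    (cycField p).val.injective

theorem stdAddChar_eq_omega_pow (p : ℕ) [hp : Fact p.Prime] (x : ZMod p) :
    (ZMod.stdAddChar x : ℂ) = omega p ^ x.val := by
  conv_lhs => rw [← ZMod.natCast_zmod_val x, ← Int.cast_natCast, ZMod.stdAddChar_coe]
  rw [omega, ← Complex.exp_nat_mul]
  congr 1
  push_cast
  ring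

/-- An element of the Galois group of `ℚ(ω)` raises `ω` to a power prime to `p`. -/
theorem exists_galois_pow (p : ℕ) [hp : Fact p.Prime] (σ : Gal(cycField p/ℚ)) :
    ∃ m : ℕ, m.Coprime p ∧ σ (omegaK p) = omegaK p ^ m := by
  have h : IsPrimitiveRoot (σ (omegaK p)) p :=
    (isPrimitiveRoot_omegaK p).map_of_injective σ.injective
  obtain ⟨m, -, hm⟩ := (isPrimitiveRoot_omegaK p).eq_pow_of_pow_eq_one h.pow_eq_one
  refine ⟨m, ?_, hm.symm⟩
  rw [← hm] at h
  exact ((isPrimitiveRoot_omegaK p).pow_iff_coprime hp.out.pos m).1 h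

/-- `ψ(g) = σ(χ(g))` for values of two functions. -/
def GaloisRel {p : ℕ} (σ : Gal(cycField p/ℚ)) (x y : ℂ) : Prop :=
  ∃ z : cycField p, (z : ℂ) = x ∧ ((σ z : cycField p) : ℂ) = y

theorem galoisRel_zero {p : ℕ} (σ : Gal(cycField p/ℚ)) : GaloisRel σ 0 0 :=
  ⟨0, by simp⟩

theorem galoisRel_sum {p : ℕ} {σ : Gal(cycField p/ℚ)} {ι : Type} [Fintype ι] {f g : ι → ℂ}
    (h : ∀ i, GaloisRel σ (f i) (g i)) : GaloisRel σ (∑ i, f i) (∑ i, g i) := by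
  choose z h1 h2 using h
  exact ⟨∑ i, z i, by simp [h1], by simp [h2]⟩

theorem galoisRel_prod {p : ℕ} {σ : Gal(cycField p/ℚ)} {ι : Type} [Fintype ι] {f g : ι → ℂ}
    (h : ∀ i, GaloisRel σ (f i) (g i)) : GaloisRel σ (∏ i, f i) (∏ i, g i) := by
  choose z h1 h2 using h
  exact ⟨∏ i, z i, by simp [h1], by simp [h2]⟩

theorem galoisRel_of_pow_eq_one {p m : ℕ} [Fact p.Prime] {σ : Gal(cycField p/ℚ)}
    (hσ : σ (omegaK p) = omegaK p ^ m) {x : ℂ} (hx : x ^ p = 1) : GaloisRel σ x (x ^ m) := by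
  obtain ⟨i, -, rfl⟩ := (isPrimitiveRoot_omega p).eq_pow_of_pow_eq_one hx
  refine ⟨omegaK p ^ i, rfl, ?_⟩
  rw [map_pow, hσ, ← pow_mul, ← pow_mul, mul_comm]
  rfl

theorem galoisRel_indFun {p : ℕ} {σ : Gal(cycField p/ℚ)} {D Q : Type} [Group D] [Group Q]
    [Fintype Q] [DecidableEq Q] {θ θ' : Q → D → ℂ} (h : ∀ i d, GaloisRel σ (θ i d) (θ' i d))
    (w : D ≀ᵣ Q) : GaloisRel σ (indFun θ w) (indFun θ' w) := by
  unfold indFun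
  split_ifs
  · exact galoisRel_sum fun q => galoisRel_prod fun i => h _ _
  · exact galoisRel_zero σ

theorem galoisRel_phi {m : ℕ} {σ : Gal(cycField 5/ℚ)} (hσ : σ (omegaK 5) = omegaK 5 ^ m)
    (ε : ZMod 5) (c : Cyc 5) : GaloisRel σ (phi 5 (1 * ε) c) (phi 5 (m * ε) c) := by
  rw [one_mul, phi_mul_apply, map_pow]
  refine galoisRel_of_pow_eq_one hσ ?_
  rw [← map_pow, show c ^ 5 = 1 from by revert c; decide, map_one]

theorem galoisRel_rootChar {m : ℕ} {σ : Gal(cycField 5/ℚ)} (hσ : σ (omegaK 5) = omegaK 5 ^ m)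
    (w : Wr 5 3) : GaloisRel σ (rootChar 1 w) (rootChar m w) := by
  refine galoisRel_indFun (fun i d => ?_) _
  unfold childChar
  split_ifs
  · exact galoisRel_indFun (fun j e => galoisRel_phi hσ _ _) _
  · exact galoisRel_phi hσ _ _

/-- The Galois group of `ℚ(e^{2πi/5})` is generated by an element raising the root of unity to the
third power. -/
theorem exists_galois_generator : ∃ σ : Gal(cycField 5/ℚ), Subgroup.zpowers σ = ⊤ ∧
    σ (omegaK 5) = omegaK 5 ^ 3 := by
  have : IsCyclotomicExtension {5} ℚ (cycField 5) := by
    change IsCyclotomicExtension {5} ℚ (cycField 5).toSubalgebra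
    rw [IntermediateField.adjoin_simple_toSubalgebra_of_isAlgebraic
      ((isPrimitiveRoot_omega 5).isIntegral (by norm_num)).tower_top.isAlgebraic]
    exact (isPrimitiveRoot_omega 5).adjoin_isCyclotomicExtension ℚ
  let e := IsCyclotomicExtension.autEquivPow (cycField 5) (n := 5)
    (Polynomial.cyclotomic.irreducible_rat (by norm_num))
  let u : (ZMod 5)ˣ := ZMod.unitOfCoprime 3 (by norm_num)
  refine ⟨e.symm u, ?_, ?_⟩
  · refine (Subgroup.eq_top_iff' _).2 fun τ => ?_
    -- 3 is a primitive root modulo 5.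
    have : ∀ v : (ZMod 5)ˣ, ∃ k : Fin 4, v = u ^ (k : ℕ) := by decide
    obtain ⟨k, hk⟩ := this (e τ)
    refine ⟨(k : ℕ), ?_⟩
    simp only [zpow_natCast]
    rw [← map_pow, ← hk, MulEquiv.symm_apply_apply]
  · have hζ := IsCyclotomicExtension.zeta_spec 5 ℚ (cycField 5)
    have h : (e.symm u) (IsCyclotomicExtension.zeta 5 ℚ (cycField 5)) =
        IsCyclotomicExtension.zeta 5 ℚ (cycField 5) ^ 3 := by
      rw [← hζ.autToPow_spec ℚ (e.symm u)]
      have h1 : hζ.autToPow ℚ (e.symm u) = u := e.apply_symm_apply u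
      rw [h1]
      rfl
    -- The chosen root `zeta` need not be `omegaK 5`, but `omegaK 5` is a power of it and is cubed
    -- as well.
    obtain ⟨i, -, hi⟩ := hζ.eq_pow_of_pow_eq_one (isPrimitiveRoot_omegaK 5).pow_eq_one
    rw [← hi, map_pow, h, ← pow_mul, ← pow_mul, mul_comm]

theorem sylow_linear_galois (p n : ℕ) [Fact p.Prime] (P : Sylow p (Equiv.Perm (Fin n)))
    (σ : Gal(cycField p/ℚ)) :
    ∃ h : Subgroup.normalizer ((P : Subgroup (Equiv.Perm (Fin n))) :
        Set (Equiv.Perm (Fin n))),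
      ∀ l : ↥P →* ℂˣ, IsGaloisImage σ (fun x : ↥(P : Subgroup (Equiv.Perm (Fin n))) => (l x : ℂ))
        (conjBy (fun x : ↥(P : Subgroup (Equiv.Perm (Fin n))) => (l x : ℂ)) h) := by
  obtain ⟨m, hm, hσ⟩ := exists_galois_pow p σ
  obtain ⟨hp, hP⟩ := sylow_perm_linear p n P
  obtain ⟨h, hh⟩ := hP m hm
  refine ⟨h, fun l x => ?_⟩
  have h1 : (l x : ℂ) ^ p = 1 := by
    rw [← Units.val_pow_eq_pow_val, hp, Units.val_one]
  have h2 := galoisRel_of_pow_eq_one hσ h1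
  rw [← Units.val_pow_eq_pow_val, ← hh] at h2
  exact h2

end GaloisAction

/-! ### Normalizing permutations in coordinates -/

section NormalizerAction

/-- The permutation of `(ℤ/5)³` given by an element of the iterated wreath product. -/
def act (a : ZMod 5) (b : ZMod 5 → ZMod 5) (c : ZMod 5 → ZMod 5 → ZMod 5)
    (s : ZMod 5 × ZMod 5 × ZMod 5) : ZMod 5 × ZMod 5 × ZMod 5 :=
  (a + s.1, b (a + s.1) + s.2.1, c (a + s.1) (b (a + s.1) + s.2.1) + s.2.2)

/-- The element of the iterated wreath product `P_125` with given components. -/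
def el (a : ZMod 5) (b : ZMod 5 → ZMod 5) (c : ZMod 5 → ZMod 5 → ZMod 5) : Wr 5 3 :=
  (⟨fun x => (⟨fun y => (⟨fun _ => (1 : Wr 5 0), Multiplicative.ofAdd (c x.toAdd y.toAdd)⟩ :
      Wr 5 0 ≀ᵣ Cyc 5), Multiplicative.ofAdd (b x.toAdd)⟩ : Wr 5 1 ≀ᵣ Cyc 5),
    Multiplicative.ofAdd a⟩ : Wr 5 2 ≀ᵣ Cyc 5)

theorem exists_eq_el (w : Wr 5 3) : ∃ a b c, w = el a b c := by
  refine ⟨w.right.toAdd, fun x => (w.left (Multiplicative.ofAdd x)).right.toAdd, fun x y =>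
    ((w.left (Multiplicative.ofAdd x)).left (Multiplicative.ofAdd y)).right.toAdd, ?_⟩
  rfl

/-- The points permuted by `P_125`, as triples (of coordinates from the top to the bottom). -/
def pt : ZMod 5 × ZMod 5 × ZMod 5 ≃ Pts 5 3 where
  toFun s := (Fin.succFunEquiv (Cyc 5) 2).symm ((Fin.succFunEquiv (Cyc 5) 1).symm
    ((Fin.succFunEquiv (Cyc 5) 0).symm (default, Multiplicative.ofAdd s.2.2),
      Multiplicative.ofAdd s.2.1), Multiplicative.ofAdd s.1)
  invFun x := ((x 2).toAdd, (x 1).toAdd, (x 0).toAdd)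
  left_inv _ := rfl
  right_inv x := by
    funext i
    fin_cases i <;> rfl

theorem iteratedWreathToPermHom_el (a : ZMod 5) (b : ZMod 5 → ZMod 5)
    (c : ZMod 5 → ZMod 5 → ZMod 5) (s : ZMod 5 × ZMod 5 × ZMod 5) :
    iteratedWreathToPermHom (Cyc 5) 3 (el a b c) (pt s) = pt (act a b c s) := rfl

/-- The shape of a permutation `h` of `(ℤ/5)³` normalizing `P_125`. -/
theorem normalizer_structure (h : Equiv.Perm (ZMod 5 × ZMod 5 × ZMod 5))
    (hh : ∀ a b c, ∃ a' b' c', ∀ s, h (act a b c s) = act a' b' c' (h s)) :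
    ∃ (a u x₀ : ZMod 5) (v : ZMod 5 → ZMod 5), a ≠ 0 ∧ u ≠ 0 ∧ ∀ b c a' b' c',
      (∀ s, h (act 0 b c s) = act a' b' c' (h s)) → a' = 0 ∧
        (∀ x, b' (a * x + x₀) = u * b x) ∧
        ∀ x y, b x = 0 → (c' (a * x + x₀) (u * y + v x) = 0 ↔ c x y = 0) := by
  -- Use an element that carries (x, y, z) to (x, y', z') and fixes a point over x + 1. Its
  -- conjugate has a fixed point, so it preserves first coordinates. The same device one level down
  -- gives `mid`.
  have top : ∀ x y z y' z', (h (x, y, z)).1 = (h (x, y', z')).1 := by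
    intro x y z y' z'
    obtain ⟨a', b', c', H⟩ := hh 0 (Pi.single x (y' - y)) (Pi.single x fun _ => z' - z)
    have e1 := H (x, y, z)
    have e2 := H (x + 1, 0, 0)
    have hx : x + 1 ≠ x := by simp
    simp [act, hx] at e1 e2
    have h2 := congrArg Prod.fst e2
    simp at h2
    rw [e1, h2]
    simp
  have mid : ∀ x y z z', (h (x, y, z)).2.1 = (h (x, y, z')).2.1 := by
    intro x y z z'
    obtain ⟨a', b', c', H⟩ := hh 0 0 (Pi.single x (Pi.single y (z' - z)))
    have e1 := H (x, y, z)
    have e2 := H (x, y + 1, 0)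
    have hx : y + 1 ≠ y := by simp
    simp [act, hx] at e1 e2
    have h2 := congrArg Prod.fst e2
    simp at h2
    have h3 := congrArg (fun s => s.2.1) e2
    simp [h2, top x (y + 1) 0 y z] at h3
    rw [e1, h2]
    simp [h3]
  have inj0 : Function.Injective fun x => (h (x, 0, 0)).1 := by
    refine Finite.injective_iff_surjective.2 fun x' => ?_
    obtain ⟨⟨x, y, z⟩, hs⟩ := h.surjective (x', 0, 0)
    exact ⟨x, by rw [top x 0 0 y z, hs]⟩
  have inj1 : Function.Injective fun y => (h (0, y, 0)).2.1 := by
    refine Finite.injective_iff_surjective.2 fun y' => ?_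
    obtain ⟨⟨x, y, z⟩, hs⟩ := h.surjective ((h (0, 0, 0)).1, y', 0)
    have hx : x = 0 := inj0 (by
      change (h (x, 0, 0)).1 = _
      rw [top x 0 0 y z, hs])
    subst hx
    exact ⟨y, by simp only [mid 0 y 0 z, hs]⟩
  obtain ⟨a, β, γ, hβ⟩ := hh 1 0 0
  obtain ⟨x₀, hx₀⟩ : ∃ x₀, (h (0, 0, 0)).1 = x₀ := ⟨_, rfl⟩
  obtain ⟨v, hv⟩ : ∃ v : ZMod 5 → ZMod 5, ∀ x, (h (x, 0, 0)).2.1 = v x := ⟨_, fun _ => rfl⟩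
  have step0 : ∀ x y z, (h (1 + x, y, z)).1 = a + (h (x, y, z)).1 := by
    intro x y z
    have := congrArg Prod.fst (hβ (x, y, z))
    simpa [act] using this
  -- The increment depends only on the first coordinate of the image, so the slope in y is the same
  -- over every x.
  have step1 : ∀ x y z, (h (1 + x, y, z)).2.1 = β ((h (1 + x, y, z)).1) + (h (x, y, z)).2.1 := by
    intro x y z
    have := congrArg (fun s => s.2.1) (hβ (x, y, z))
    rw [step0]
    simpa [act] using this
  have ind : ∀ (p : ZMod 5 → Prop), p 0 → (∀ x, p x → p (1 + x)) → ∀ x, p x := by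
    intro p h0 hs x
    have : ∀ n : ℕ, p (n : ZMod 5) := by
      intro n
      induction n with
      | zero => simpa using h0
      | succ n ih =>
        rw [Nat.cast_succ, add_comm]
        exact hs _ ih
    rw [← ZMod.natCast_zmod_val x]
    exact this _
  have form0 : ∀ x y z, (h (x, y, z)).1 = a * x + x₀ := by
    intro x y z
    rw [top x y z 0 0]
    revert x
    refine ind _ (by simp [hx₀]) fun x hx => ?_
    rw [step0, hx]
    ring
  -- Shifting all second coordinates by 1 reveals the slope `u = b₂ x₀` over x = 0.
  obtain ⟨a₂, b₂, c₂, H₂⟩ := hh 0 (fun _ => 1) 0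
  have ha₂ : a₂ = 0 := by
    have := congrArg Prod.fst (H₂ (0, 0, 0))
    simp only [act, zero_add, form0] at this
    simpa using this
  subst ha₂
  have step2 : ∀ y, (h (0, 1 + y, 0)).2.1 = b₂ x₀ + (h (0, y, 0)).2.1 := by
    intro y
    have := congrArg (fun s => s.2.1) (H₂ (0, y, 0))
    simp only [act, zero_add, form0] at this
    simpa using this
  obtain ⟨u, hu⟩ : ∃ u, b₂ x₀ = u := ⟨_, rfl⟩
  have form1 : ∀ x y z, (h (x, y, z)).2.1 = u * y + v x := by
    intro x y z
    rw [mid x y z 0]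
    revert x
    refine ind _ ?_ fun x hx => ?_
    · revert y
      refine ind _ (by simp [hv]) fun y hy => ?_
      rw [step2, hy, hu]
      ring
    · have := step1 x 0 0
      rw [form0, hv, hv] at this
      rw [step1, hx, form0, this]
      ring
  refine ⟨a, u, x₀, v, ?_, ?_, ?_⟩
  · rintro rfl
    have : (1 : ZMod 5) = 0 := inj0 (by simp only [form0 1 0 0, form0 0 0 0, zero_mul])
    exact absurd this (by decide)
  · intro hu0
    have : (1 : ZMod 5) = 0 := inj1 (by simp only [form1 0 1 0, form1 0 0 0, hu0, zero_mul])
    exact absurd this (by decide)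
  intro b c a' b' c' H
  have ha' : a' = 0 := by
    have := congrArg Prod.fst (H (0, 0, 0))
    simp only [act, zero_add, form0] at this
    simpa using this
  subst ha'
  refine ⟨rfl, fun x => ?_, fun x y hb => ?_⟩
  · have := congrArg (fun s => s.2.1) (H (x, 0, 0))
    simp only [act, zero_add, form0 x 0 0] at this
    rw [form1] at this
    rw [add_zero, hv] at this
    exact (add_right_cancel this).symm
  -- When `b x = 0`, vanishing of `c x y` means that the point is fixed, and `h` transports fixed
  -- points.
  · have e := H (x, y, 0)
    have e3 := congrArg (fun s => s.2.2) e
    simp only [act, zero_add, hb, form0 x y 0] at e3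
    have hb' : b' (a * x + x₀) = 0 := by
      have := congrArg (fun s => s.2.1) e
      simp only [act, zero_add, hb, form0 x y 0] at this
      rw [form1 x y, form1 x y] at this
      simpa using this
    rw [hb', zero_add, form1 x y 0] at e3
    constructor
    · intro hc
      rw [hc, zero_add] at e3
      have : h (x, y, c x y + 0) = h (x, y, 0) := by
        refine Prod.ext ?_ (Prod.ext ?_ e3)
        · rw [form0, form0 x y 0]
        · rw [form1, form1 x y 0]
      simpa using h.injective this
    · intro hc
      rw [hc, add_zero] at e3
      simpa using e3

end NormalizerAction

/-! ### Sums of five fifth roots of unity -/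

section Values

/-- Sums of five fifth roots of unity determine their terms. -/
theorem card_eq_of_sum_stdAddChar_eq {f g : ZMod 5 → ZMod 5}
    (h : ∑ r, (ZMod.stdAddChar (f r) : ℂ) = ∑ r, (ZMod.stdAddChar (g r) : ℂ)) (e : ZMod 5) :
    (Finset.univ.filter fun r => f r = e).card = (Finset.univ.filter fun r => g r = e).card := by
  open Polynomial in
  let S : (ZMod 5 → ZMod 5) → ℚ[X] := fun f => ∑ r, X ^ (f r).val
  have hdeg : ∀ f, (S f).degree < (5 : ℕ) := fun f => by
    refine (degree_sum_le _ _).trans_lt ((Finset.sup_lt_iff (WithBot.bot_lt_coe 5)).2 fun r _ => ?_)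
    rw [degree_X_pow]
    exact_mod_cast (f r).val_lt
  have hroot : aeval (omega 5) (S f - S g) = 0 := by
    rw [map_sub, sub_eq_zero]
    simpa [S, stdAddChar_eq_omega_pow] using h
  have hdvd : cyclotomic 5 ℚ ∣ S f - S g := by
    rw [cyclotomic_eq_minpoly_rat (isPrimitiveRoot_omega 5) (by norm_num)]
    exact minpoly.dvd ℚ _ hroot
  have hzero : S f - S g = 0 := by
    obtain ⟨R, hR⟩ := hdvd
    -- Both polynomials have value 5 at 1, where the cyclotomic polynomial does not vanish. So X - 1
    -- is a further factor, and X ^ 5 - 1 divides a polynomial of degree below 5.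
    have h1 : R.eval 1 = 0 := by
      have := congrArg (eval 1) hR
      simpa [S, eval_finsetSum, eval_one_cyclotomic_prime] using this
    obtain ⟨R', rfl⟩ := dvd_iff_isRoot.2 h1
    have h5 : (X ^ 5 - 1 : ℚ[X]) ∣ S f - S g := by
      refine ⟨R', ?_⟩
      rw [hR, ← cyclotomic_prime_mul_X_sub_one ℚ 5, map_one, mul_assoc]
    refine eq_zero_of_dvd_of_degree_lt h5 ?_
    rw [← C_1, degree_X_pow_sub_C (by norm_num)]
    exact (degree_sub_le _ _).trans_lt (max_lt (hdeg f) (hdeg g))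
  have hcoeff : ∀ f, (S f).coeff e.val = ((Finset.univ.filter fun r => f r = e).card : ℚ) := by
    intro f
    simp only [S, finsetSum_coeff, coeff_X_pow, Finset.card_filter]
    push_cast
    refine Finset.sum_congr rfl fun r _ => if_congr ?_ rfl rfl
    exact ⟨fun h => (ZMod.val_injective 5 h).symm, fun h => by rw [h]⟩
  have := congrArg (fun P => P.coeff e.val) (sub_eq_zero.1 hzero)
  simp only [hcoeff] at this
  exact_mod_cast this

end Values

/-! ### Failure of normalizer conjugacy -/

section Nonconjugacy

theorem stdAddChar_sum {ι : Type} (s : Finset ι) (f : ι → ZMod 5) :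
    (ZMod.stdAddChar (∑ i ∈ s, f i) : ℂ) = ∏ i ∈ s, ZMod.stdAddChar (f i) := by
  classical
  induction s using Finset.induction_on with
  | empty => simp
  | insert i s hi ih => rw [Finset.sum_insert hi, Finset.prod_insert hi, AddChar.map_add_eq_mul, ih]

/-- The value of `innerChar` on the base group. -/
noncomputable def innerSum (u : ZMod 5) (d : ZMod 5 → ZMod 5) : ℂ :=
  ∑ r : ZMod 5, ZMod.stdAddChar (u * ∑ k : ZMod 5, leafLabel (Multiplicative.ofAdd (r + k)) * d k)

/-- The element of `P_25` with given components. -/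
def el₂ (b : ZMod 5) (d : ZMod 5 → ZMod 5) : Wr 5 2 :=
  (⟨fun y => (⟨fun _ => (1 : Wr 5 0), Multiplicative.ofAdd (d y.toAdd)⟩ :
      Wr 5 0 ≀ᵣ Cyc 5), Multiplicative.ofAdd b⟩ : Wr 5 1 ≀ᵣ Cyc 5)

theorem innerChar_el₂_zero (u : ZMod 5) (d : ZMod 5 → ZMod 5) :
    innerChar u (el₂ 0 d) = innerSum u d := by
  refine (indFun_base _ _).trans ?_
  refine Fintype.sum_equiv Multiplicative.toAdd _ _ fun q => ?_
  rw [Finset.mul_sum, stdAddChar_sum]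
  refine Fintype.prod_equiv Multiplicative.toAdd _ _ fun i => ?_
  rw [← mul_assoc]
  rfl

theorem innerChar_el₂_of_ne (u : ZMod 5) {b : ZMod 5} (hb : b ≠ 0) (d : ZMod 5 → ZMod 5) :
    innerChar u (el₂ b d) = 0 :=
  indFun_of_ne_one _ hb

theorem childChar_of_eq (u : ZMod 5) {j : Cyc 5} (hj : j.toAdd = 1) (d : Wr 5 2) :
    childChar u j d = innerChar u d := if_pos hj

theorem childChar_el₂_of_ne (u : ZMod 5) {j : Cyc 5} (hj : j.toAdd ≠ 1) (b : ZMod 5)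
    (d : ZMod 5 → ZMod 5) :
    childChar u j (el₂ b d) = ZMod.stdAddChar (u * (midLabel j * b)) := by
  rw [childChar, if_neg hj, ← mul_assoc]
  rfl

/-- `innerChar` vanishes off its base group. Hence the only surviving translate is the one that
places the first child over `x₀`, the sole zero of `b`. -/
theorem rootChar_el (u x₀ : ZMod 5) {b : ZMod 5 → ZMod 5} (c : ZMod 5 → ZMod 5 → ZMod 5)
    (hb : ∀ x, b x = 0 ↔ x = x₀) : rootChar u (el 0 b c) =
      ZMod.stdAddChar (u * ∑ i : ZMod 5, midLabel (Multiplicative.ofAdd (1 - x₀ + i)) * b i) *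
        innerSum u (c x₀) := by
  have h : rootChar u (el 0 b c) = ∑ q : Cyc 5, ∏ i : Cyc 5,
      childChar u (q * i) (el₂ (b i.toAdd) (c i.toAdd)) := indFun_base _ _
  rw [h, Finset.sum_eq_single (Multiplicative.ofAdd (1 - x₀))]
  · have hfac : ∀ i : Cyc 5,
        childChar u (Multiplicative.ofAdd (1 - x₀) * i) (el₂ (b i.toAdd) (c i.toAdd)) =
          ZMod.stdAddChar (u * (midLabel (Multiplicative.ofAdd (1 - x₀ + i.toAdd)) * b i.toAdd)) *
            if i = Multiplicative.ofAdd x₀ then innerSum u (c x₀) else 1 := by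
      intro i
      by_cases hi : i = Multiplicative.ofAdd x₀
      · have hi' : i.toAdd = x₀ := congrArg Multiplicative.toAdd hi
        rw [if_pos hi, hi', childChar_of_eq _ (by simp [hi']), (hb x₀).2 rfl,
          innerChar_el₂_zero]
        simp
      · rw [if_neg hi, mul_one, childChar_el₂_of_ne]
        · rfl
        · intro h1
          apply hi
          have h2 : 1 - x₀ + i.toAdd = 1 := h1
          have h3 : i.toAdd = x₀ := by linear_combination h2
          rw [← h3, ofAdd_toAdd]
    rw [Finset.prod_congr rfl fun i _ => hfac i, Finset.prod_mul_distrib,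
      Finset.prod_ite_eq' Finset.univ, if_pos (Finset.mem_univ _), Finset.mul_sum,
      stdAddChar_sum]
    congr 1
  · intro q _ hq
    refine Finset.prod_eq_zero (Finset.mem_univ (q⁻¹ * Multiplicative.ofAdd 1)) ?_
    rw [childChar_of_eq _ (by simp), innerChar_el₂_of_ne]
    intro h0
    apply hq
    have h2 := (hb _).1 h0
    simp only [toAdd_mul, toAdd_inv, toAdd_ofAdd] at h2
    have h3 : q.toAdd = 1 - x₀ := by linear_combination -h2
    rw [← h3, ofAdd_toAdd]
  · simp

/-- A test function vanishing only at the first child of the root. -/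
def testFun (k x : ZMod 5) : ZMod 5 := if x = 1 then 0 else if x = k then 2 else 1

theorem testFun_eq_zero_iff (k x : ZMod 5) : testFun k x = 0 ↔ x = 1 := by
  revert k x
  decide

/-- Subtracting the case k = 1 isolates 3 · mid(k) = u · mid(1 + a(k - 1)) for k ≠ 1, with mid short
for `midLabel`. Away from child 1 the label 0 occurs only at child 2, so k = 2 gives a = 1, and then
u = 3. -/
theorem scalars_eq (a u : ZMod 5) (ha : a ≠ 0) (hu : u ≠ 0)
    (h : ∀ k, 3 * ∑ i, midLabel (Multiplicative.ofAdd i) * testFun k i =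
      ∑ x, midLabel (Multiplicative.ofAdd (1 + a * (x - 1))) * (u * testFun k x)) :
    a = 1 ∧ u = 3 := by
  revert a u
  decide +kernel

/-- On the left the exponents are 0 once and 1 and 3 twice each. On the right they are w₀ twice, w₁
twice and w₀ + w₁ once. Agreement would need {w₀, w₁} = {1, 3} with w₀ + w₁ = 0. -/
theorem distribution_ne (v w₀ w₁ : ZMod 5) (h₀ : w₀ ≠ 0) (h₁ : w₁ ≠ 0) :
    ∃ e, (Finset.univ.filter fun r : ZMod 5 => 3 * (∑ k : ZMod 5,
        leafLabel (Multiplicative.ofAdd (r + k)) * if k = 0 ∨ k = 1 then 1 else 0) = e).card ≠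
      (Finset.univ.filter fun r : ZMod 5 => 1 * (∑ k : ZMod 5,
        leafLabel (Multiplicative.ofAdd (r + k)) * if k = v then w₀ else
          if k = 3 + v then w₁ else 0) = e).card := by
  revert v w₀ w₁
  decide +kernel

theorem rootChar_not_conj (h : Equiv.Perm (ZMod 5 × ZMod 5 × ZMod 5)) :
    ¬ ∀ a b c, ∃ a' b' c', (∀ s, h (act a b c s) = act a' b' c' (h s)) ∧
      rootChar 3 (el a b c) = rootChar 1 (el a' b' c') := by
  intro hh
  obtain ⟨a, u, x₀, v, ha, hu, H⟩ := normalizer_structure h fun a b c => by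
    obtain ⟨a', b', c', h1, -⟩ := hh a b c
    exact ⟨a', b', c', h1⟩
  have affine : Function.Bijective fun x : ZMod 5 => a * x + x₀ :=
    (Equiv.addRight x₀).bijective.comp (mulLeft_bijective₀ a ha)
  have hroot : ∀ (k : ZMod 5) (c : ZMod 5 → ZMod 5 → ZMod 5),
      ∃ b' : ZMod 5 → ZMod 5, ∃ c' : ZMod 5 → ZMod 5 → ZMod 5,
      (∀ x y, testFun k x = 0 → (c' (a * x + x₀) (u * y + v x) = 0 ↔ c x y = 0)) ∧
      ZMod.stdAddChar (3 * ∑ i : ZMod 5, midLabel (Multiplicative.ofAdd i) * testFun k i) *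
        innerSum 3 (c 1) =
      ZMod.stdAddChar (∑ x, midLabel (Multiplicative.ofAdd (1 + a * (x - 1))) *
        (u * testFun k x)) * innerSum 1 (c' (a * 1 + x₀)) := by
    intro k c
    obtain ⟨a', b', c', h1, h2⟩ := hh 0 (testFun k) c
    obtain ⟨rfl, hb', hc'⟩ := H _ _ _ _ _ h1
    refine ⟨b', c', hc', ?_⟩
    rw [rootChar_el 3 1 c (testFun_eq_zero_iff k),
      rootChar_el 1 (a * 1 + x₀) c' (fun x => ?_)] at h2
    · rw [one_mul, ← affine.sum_comp
        fun i => midLabel (Multiplicative.ofAdd (1 - (a * 1 + x₀) + i)) * b' i] at h2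
      simp only [hb'] at h2
      convert h2 using 3
      · simp
      · refine Finset.sum_congr rfl fun x _ => ?_
        congr 3
        ring
    · obtain ⟨x, rfl⟩ := affine.2 x
      rw [hb', mul_eq_zero, or_iff_right hu, testFun_eq_zero_iff, affine.1.eq_iff]
  have five : ∀ w, innerSum w 0 = 5 := fun w => by simp [innerSum]
  have hexp : ∀ k, 3 * ∑ i, midLabel (Multiplicative.ofAdd i) * testFun k i =
      ∑ x, midLabel (Multiplicative.ofAdd (1 + a * (x - 1))) * (u * testFun k x) := by
    intro k
    -- With c = 0 the transported c' vanishes over the image of child 1 too, so both inner factors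
    -- equal 5 and only the exponents are compared.
    obtain ⟨b', c', hc', e⟩ := hroot k 0
    have hc0 : c' (a * 1 + x₀) = 0 := by
      funext y'
      have := (hc' 1 (u⁻¹ * (y' - v 1)) ((testFun_eq_zero_iff k 1).2 rfl)).2 rfl
      rwa [mul_inv_cancel_left₀ hu, sub_add_cancel] at this
    rw [hc0, Pi.zero_apply, five, five] at e
    exact ZMod.injective_stdAddChar (mul_right_cancel₀ (by norm_num) e)
  obtain ⟨rfl, rfl⟩ := scalars_eq a u ha hu hexp
  -- The outer factors now agree and cancel. The adjacent support {0, 1} goes to {v 1, 3 + v 1},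
  -- with unknown nonzero values there.
  obtain ⟨b', c', hc', e⟩ := hroot 1 fun _ y => if y = 0 ∨ y = 1 then 1 else 0
  rw [hexp] at e
  have e' := mul_left_cancel₀ (by
    rw [stdAddChar_eq_omega_pow]
    exact pow_ne_zero _ ((isPrimitiveRoot_omega 5).ne_zero (by norm_num))) e
  have hz : ∀ y, c' (1 * 1 + x₀) (3 * y + v 1) = 0 ↔ ¬ (y = 0 ∨ y = 1) := fun y => by
    rw [hc' 1 y ((testFun_eq_zero_iff 1 1).2 rfl)]
    simp
  have hform : c' (1 * 1 + x₀) = fun k => if k = v 1 then c' (1 * 1 + x₀) (v 1) else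
      if k = 3 + v 1 then c' (1 * 1 + x₀) (3 + v 1) else 0 := by
    funext k
    split_ifs with h1 h2
    · rw [h1]
    · rw [h2]
    -- 2 is the inverse of 3 modulo 5.
    · have h3 : (3 : ZMod 5) * (2 * (k - v 1)) + v 1 = k := by
        have : (6 : ZMod 5) = 1 := rfl
        linear_combination (k - v 1) * this
      rw [← h3, hz, not_or]
      refine ⟨fun h4 => h1 ?_, fun h4 => h2 ?_⟩
      · rw [← h3, h4]
        ring
      · rw [← h3, h4]
        ring
  have hw₀ : c' (1 * 1 + x₀) (v 1) ≠ 0 := by simpa using (hz 0).not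
  have hw₁ : c' (1 * 1 + x₀) (3 + v 1) ≠ 0 := by simpa using (hz 1).not
  obtain ⟨e₀, he⟩ := distribution_ne (v 1) _ _ hw₀ hw₁
  rw [hform] at e'
  exact he (card_eq_of_sum_stdAddChar_eq e' e₀)

theorem treeChar_not_conj :
    ¬ ∃ h : Subgroup.normalizer ((sylowWr 5 3 : Subgroup (Equiv.Perm (Pts 5 3))) :
      Set (Equiv.Perm (Pts 5 3))), treeChar 5 3 t₂ = conjBy (treeChar 5 3 t₁) h := by
  rintro ⟨h, hh⟩
  apply rootChar_not_conj (pt.symm.permCongr h)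
  intro a b c
  let x : ↥(sylowWr 5 3) := (sylowEquiv 5 3).symm (el a b c)
  let y : ↥(sylowWr 5 3) := (sylowWr 5 3 : Subgroup (Equiv.Perm (Pts 5 3))).normalizerMonoidHom h x
  obtain ⟨a', b', c', hy⟩ := exists_eq_el (sylowEquiv 5 3 y)
  refine ⟨a', b', c', fun s => ?_, ?_⟩
  · have hy' : y = (sylowEquiv 5 3).symm (el a' b' c') := by
      rw [← hy, MulEquiv.symm_apply_apply]
    -- Written as y h = h x, conjugation becomes the intertwining relation on points that
    -- `rootChar_not_conj` excludes.
    have h1 : (y : Equiv.Perm (Pts 5 3)) * h = h * x := by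
      change (h : Equiv.Perm (Pts 5 3)) * x * (h : Equiv.Perm (Pts 5 3))⁻¹ * h = h * x
      rw [inv_mul_cancel_right]
    have h2 := DFunLike.congr_fun h1 (pt s)
    rw [hy'] at h2
    have h3 : (x : Equiv.Perm (Pts 5 3)) (pt s) = pt (act a b c s) :=
      iteratedWreathToPermHom_el a b c s
    have h4 : iteratedWreathToPermHom (Cyc 5) 3 (el a' b' c')
        (pt (pt.symm ((h : Equiv.Perm (Pts 5 3)) (pt s)))) =
        (h : Equiv.Perm (Pts 5 3)) (pt (act a b c s)) := by
      rw [Equiv.apply_symm_apply, ← h3]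
      exact h2
    rw [iteratedWreathToPermHom_el] at h4
    simp [Equiv.permCongr_apply, ← h4]
  · have h1 := congrFun hh x
    rw [treeChar_t₂, show conjBy (treeChar 5 3 t₁) h x = treeChar 5 3 t₁ y from rfl,
      treeChar_t₁, hy, MulEquiv.apply_symm_apply] at h1
    exact h1

end Nonconjugacy

end SylowChar

open SylowChar
theorem mainTheorem7 :
    -- the counterexample in `S_125`
    (Nat.card (Pts 5 3) = 125 ∧
      Admissible 3 t₁ ∧ Admissible 3 t₂ ∧
      IsIrrChar (treeChar 5 3 t₁) ∧ IsIrrChar (treeChar 5 3 t₂) ∧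
      treeChar 5 3 t₁ 1 = 25 ∧ treeChar 5 3 t₂ 1 = 25 ∧
      (∃ σ : Gal(cycField 5/ℚ), Subgroup.zpowers σ = ⊤ ∧
        σ (omegaK 5) = omegaK 5 ^ 3 ∧
        IsGaloisImage σ (treeChar 5 3 t₁) (treeChar 5 3 t₂)) ∧
      (¬ ∃ h : Subgroup.normalizer ((sylowWr 5 3 : Subgroup (Equiv.Perm (Pts 5 3))) :
          Set (Equiv.Perm (Pts 5 3))), treeChar 5 3 t₂ = conjBy (treeChar 5 3 t₁) h) ∧
      inducedFun (treeChar 5 3 t₁) = inducedFun (treeChar 5 3 t₂)) ∧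
    -- the contrast with linear characters
    (∀ (p n : ℕ) [Fact p.Prime] (P : Sylow p (Equiv.Perm (Fin n))) (σ : Gal(cycField p/ℚ)),
      ∃ h : Subgroup.normalizer ((P : Subgroup (Equiv.Perm (Fin n))) :
          Set (Equiv.Perm (Fin n))),
        ∀ l : ↥P →* ℂˣ, IsGaloisImage σ (fun x : ↥(P : Subgroup (Equiv.Perm (Fin n))) => (l x : ℂ))
          (conjBy (fun x : ↥(P : Subgroup (Equiv.Perm (Fin n))) => (l x : ℂ)) h)) := by
  refine ⟨⟨by simp, admissible_t₁, admissible_t₂, isIrrChar_treeChar one_ne_zero treeChar_t₁,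
    isIrrChar_treeChar (by decide) treeChar_t₂, ?_, ?_, ?_, treeChar_not_conj,
    inducedFun_treeChar_eq⟩, fun p n _ P σ => sylow_linear_galois p n P σ⟩
  · rw [treeChar_t₁, map_one, rootChar_one]
  · rw [treeChar_t₂, map_one, rootChar_one]
  · obtain ⟨σ, hσ, h3⟩ := exists_galois_generator
    refine ⟨σ, hσ, h3, fun x => ?_⟩
    rw [treeChar_t₁, treeChar_t₂]
    exact galoisRel_rootChar h3 _
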